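/- Let $\Phi$ be a homogeneous Poisson point process of intensity $\lambda>0$ on $\mathbb R^3$, and let $\mathcal V_X=\{z:\|z-X\|\le\|z-Y\|\ \text{for all }Y\in\Phi\}$ be the Voronoi cell of the nucleus $X\in\Phi$. For $\theta\in(0,2\pi)$ and distinct $X_1,X_2\in\Phi$, let $\mathcal Z_\theta(X_1,X_2)$ be the set of points $Z$ of the facet $\mathcal V_{X_1}\cap\mathcal V_{X_2}$ that see $X_1$ and $X_2$ with angle $\theta$, that is, for which the angle $\angle X_1ZX_2\in[0,\pi]$ equals $\theta$ or $2\pi-\theta$. Pairs of nuclei are ordered by a fixed strict, translation-invariant order $<$ on $\mathbb R^3$ such that $\{x:x<0\}$ is Borel and almost every $x\in\mathbb R^3$ is comparable with $0$ (for example, comparison of the first coordinates). Write $l_1$ for length (one-dimensional Hausdorff measure) and $\mathbb E^0_\Phi$ for the Palm expectation: for a nonnegative functional $F$ of the configuration, $$\mathbb E^0_\Phi[F(\Phi)]=\frac1{\lambda|B|}\,\mathbb E\Big[\sum_{x\in\Phi\cap B}F(\Phi-x)\Big]$$ for a Borel set $B\subset\mathbb R^3$ with $0<|B|<\infty$. Then,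 for every $\theta\in(0,2\pi)$ with $\theta\neq\pi$ and every such $B$, the mean length over the ordered pairs $(0,X)$ is $$L_\theta:=\mathbb E^0_\Phi\Big[\sum_{X\in\Phi,\ X<0}l_1\big(\mathcal Z_\theta(0,X)\big)\Big]=4\pi\Big(\frac{6}{\pi\lambda}\Big)^{1/3}\Gamma\Big(\frac43\Big)\Big|\cos\frac\theta2\Big|\sin^3\frac\theta2 .$$ -/

import Mathlib

open MeasureTheory ProbabilityTheory
open scoped ENNReal NNReal

namespace PoissonVoronoi

/-- Euclidean three-space. -/
abbrev E3 : Type := EuclideanSpace ℝ (Fin 3)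

/-- A random set `Φ ω` of points of `ℝ³` is a homogeneous Poisson point process of intensity `lam`:
it is locally finite, the number of points in a bounded Borel set `B` is a random variable with the
Poisson law of mean `lam * vol B`, and the numbers of points in finitely many pairwise disjoint
bounded Borel sets are independent. -/
structure IsHomogeneousPoisson {Ω : Type*} [MeasurableSpace Ω] (P : Measure Ω)
    (Φ : Ω → Set E3) (lam : ℝ) : Prop where
  locallyFinite : ∀ ω, ∀ B : Set E3, Bornology.IsBounded B → (Φ ω ∩ B).Finite
  measurable_count : ∀ B : Set E3, MeasurableSet B → Bornology.IsBounded B →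
    Measurable fun ω => (Φ ω ∩ B).ncard
  law_count : ∀ B : Set E3, MeasurableSet B → Bornology.IsBounded B →
    P.map (fun ω => (Φ ω ∩ B).ncard) = poissonMeasure (lam * (volume B).toReal).toNNReal
  indep_count : ∀ (n : ℕ) (B : Fin n → Set E3), (∀ i, MeasurableSet (B i)) →
    (∀ i, Bornology.IsBounded (B i)) → Pairwise (fun i j => Disjoint (B i) (B j)) →
    iIndepFun (fun i ω => (Φ ω ∩ B i).ncard) P

/-- The Palm expectation `𝔼⁰[F(Φ)]` of a nonnegative functional `F` of a stationary point process
`Φ` of intensity `lam`, computed with the window `B`: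
`(lam * vol B)⁻¹ * 𝔼[∑_{x ∈ Φ ∩ B} F(Φ - x)]`. For a stationary point process this does not
depend on the Borel set `B`, as long as `0 < vol B < ∞`. -/
noncomputable def palmExpectation {Ω : Type*} [MeasurableSpace Ω] (P : Measure Ω)
    (Φ : Ω → Set E3) (lam : ℝ) (B : Set E3) (F : Set E3 → ℝ≥0∞) : ℝ≥0∞ :=
  (∫⁻ ω, ∑' x : ↥(Φ ω ∩ B), F ((fun y => y - (x : E3)) '' Φ ω) ∂P) /
    (ENNReal.ofReal lam * volume B)

/-- The Voronoi cell of the nucleus `X` in the configuration `φ`. -/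
def voronoiCell (φ : Set E3) (X : E3) : Set E3 :=
  {z | ∀ Y ∈ φ, dist z X ≤ dist z Y}

/-- The facet of the Voronoi tessellation of `φ` that is created by the nuclei `X₁` and `X₂`. -/
def facet (φ : Set E3) (X₁ X₂ : E3) : Set E3 :=
  voronoiCell φ X₁ ∩ voronoiCell φ X₂

/-- The points `Z` of the facet of `X₁` and `X₂` that see `X₁` and `X₂` with angle `θ ∈ (0, 2π)`.
The angle is measured in the plane of `X₁`, `Z`, `X₂`; as planes of `ℝ³` carry no orientation,
this says that the geometric angle, which lies in `[0, π]`, is `θ` or `2π - θ`. -/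
def angleLocus (φ : Set E3) (θ : ℝ) (X₁ X₂ : E3) : Set E3 :=
  {Z ∈ facet φ X₁ X₂ | EuclideanGeometry.angle X₁ Z X₂ = θ ∨
    EuclideanGeometry.angle X₁ Z X₂ = 2 * Real.pi - θ}

/-- The orders on `ℝ³` used to order pairs of nuclei: strict translation-invariant orders
for which `{x | x < 0}` is a Borel set and almost every point is comparable with `0`
(for instance comparison of the first coordinates, or the lexicographic order). -/
structure IsNucleusOrder (lt : E3 → E3 → Prop) : Prop where
  irrefl : ∀ x, ¬ lt x x
  trans : ∀ x y z, lt x y → lt y z → lt x z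
  translate : ∀ x y v, lt x y → lt (x + v) (y + v)
  measurable_neg : MeasurableSet {x | lt x 0}
  ae_comparable : ∀ᵐ x ∂(volume : Measure E3), lt x 0 ∨ lt 0 x

/-- The total length (one-dimensional Hausdorff measure) of the loci of angle `θ` on the facets of
the cell of `0`, over the ordered pairs `(0, X)` with `X` in the configuration and `X < 0`. -/
noncomputable def orderedLocusLength (lt : E3 → E3 → Prop) (θ : ℝ) (φ : Set E3) : ℝ≥0∞ :=
  ∑' X : {X : E3 // X ∈ φ ∧ lt X 0}, Measure.hausdorffMeasure 1 (angleLocus φ θ 0 X)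

end PoissonVoronoi

/-! For nuclei `x` and `y`, put `W = y - x`, `s = sin (θ / 2)` and `c = |cos (θ / 2)|`. By the law
of cosines, a point equidistant from both nuclei sees them with angle `θ` or `2π - θ` exactly when
its distance to them is `‖W‖ / (2 * s)`. Such points form a circle of radius `‖W‖ * c / (2 * s)`,
and one of them lies on the facet iff the open ball around it through `x` and `y` contains no
nucleus (`angleLocus_eq_image`). So the length of a locus is the circle radius times the measure of
the set of angles `t` whose ball is void (`hausdorffMeasure_angleLocus`).

Summing over pairs and applying Tonelli, one needs, for fixed `t`, the expected sum over pairs of a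
weight times a void indicator. The two-point Mecke formula `lintegral_pairMeasure_void_ball` turns
it into `lam ^ 2` times a Lebesgue integral in which the indicator becomes `exp (-lam * vol ball)`.
The Poisson hypotheses give only laws and independence of counts, so the formula is first proved for
a fixed void set by comparing measures on rectangles, then for finitely many patterns of void sets,
then by limits for a ball that moves with the pair.

The remaining integrand depends on the displacement only through its norm. Hence translation
invariance produces `volume B`, the order contributes a factor 1/2 by symmetry, `t` contributes
`2π`, and the radial integral is a Gamma integral (`lintegral_discountedRadius`). -/

namespace PoissonVoronoi

/-! ### The point process as a random measure and s-finite kernel. -/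

/-- The counting measure of a set of points. -/
noncomputable def pointMeasure (φ : Set E3) : Measure E3 :=
  Measure.sum fun x : φ => Measure.dirac (x : E3)

lemma lintegral_pointMeasure (φ : Set E3) (f : E3 → ℝ≥0∞) :
    ∫⁻ x, f x ∂pointMeasure φ = ∑' x : φ, f x := by
  simp [pointMeasure, lintegral_sum_measure]

lemma pointMeasure_apply (φ : Set E3) {s : Set E3} (hs : MeasurableSet s) :
    pointMeasure φ s = (φ ∩ s).encard := by
  rw [← lintegral_indicator_one hs, lintegral_pointMeasure, ← ENNReal.tsum_set_one,
    tsum_subtype φ (s.indicator 1), Set.indicator_indicator, tsum_subtype (φ ∩ s) fun _ => 1]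
  rfl

lemma pointMeasure_apply_eq_ncard {φ : Set E3} {s : Set E3} (hs : MeasurableSet s)
    (hfin : (φ ∩ s).Finite) : pointMeasure φ s = ((φ ∩ s).ncard : ℝ≥0∞) := by
  rw [pointMeasure_apply φ hs, ← hfin.cast_ncard_eq]
  simp

lemma pointMeasure_eq_zero_iff (φ : Set E3) {s : Set E3} (hs : MeasurableSet s) :
    pointMeasure φ s = 0 ↔ ∀ x ∈ φ, x ∉ s := by
  rw [pointMeasure_apply φ hs]
  simp [Set.eq_empty_iff_forall_notMem]

/-- The half-open annuli of integer radii. -/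
def annulus (n : ℕ) : Set E3 := {x | ⌊‖x‖⌋₊ = n}

lemma measurableSet_annulus (n : ℕ) : MeasurableSet (annulus n) :=
  (Nat.measurable_floor.comp measurable_norm) (measurableSet_singleton n)

lemma isBounded_annulus (n : ℕ) : Bornology.IsBounded (annulus n) := by
  refine (Metric.isBounded_ball (x := (0 : E3)) (r := n + 1)).subset fun x hx => ?_
  rw [mem_ball_zero_iff]
  have := Nat.lt_floor_add_one ‖x‖
  rwa [show ⌊‖x‖⌋₊ = n from hx] at this

lemma pairwise_disjoint_annulus : Pairwise (Function.onFun Disjoint annulus) := by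
  intro m n hmn
  refine Set.disjoint_left.2 fun x hx hy => hmn ?_
  exact Eq.trans (Eq.symm hx) hy

lemma iUnion_annulus : ⋃ n, annulus n = Set.univ :=
  Set.eq_univ_of_forall fun _ => Set.mem_iUnion.2 ⟨_, rfl⟩

section

variable {Ω : Type*} [MeasurableSpace Ω] {P : Measure Ω} {Φ : Ω → Set E3} {lam : ℝ}

/-- Counts are known to be measurable only on bounded sets; cutting along the annuli extends this to
every Borel set. -/
lemma IsHomogeneousPoisson.measurable_pointMeasure (h : IsHomogeneousPoisson P Φ lam) :
    Measurable fun ω => pointMeasure (Φ ω) := by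
  refine Measure.measurable_of_measurable_coe _ fun s hs => ?_
  have key : ∀ ω, pointMeasure (Φ ω) s = ∑' n, ((Φ ω ∩ (s ∩ annulus n)).ncard : ℝ≥0∞) := by
    intro ω
    conv_lhs => rw [← Set.inter_univ s, ← iUnion_annulus, Set.inter_iUnion]
    rw [measure_iUnion]
    · refine tsum_congr fun n => pointMeasure_apply_eq_ncard (hs.inter (measurableSet_annulus n)) ?_
      exact h.locallyFinite ω _ ((isBounded_annulus n).subset Set.inter_subset_right)
    · intro m n hmn
      exact (pairwise_disjoint_annulus hmn).mono Set.inter_subset_right Set.inter_subset_right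
    · exact fun n => hs.inter (measurableSet_annulus n)
  simp_rw [key]
  refine Measurable.tsum fun n => ?_
  exact (measurable_from_top (f := fun k : ℕ => (k : ℝ≥0∞))).comp
    (h.measurable_count _ (hs.inter (measurableSet_annulus n))
      ((isBounded_annulus n).subset Set.inter_subset_right))

/-- The point process as a transition kernel. -/
noncomputable def IsHomogeneousPoisson.kernel (h : IsHomogeneousPoisson P Φ lam) : Kernel Ω E3 where
  toFun ω := pointMeasure (Φ ω)
  measurable' := h.measurable_pointMeasure

lemma IsHomogeneousPoisson.kernel_apply (h : IsHomogeneousPoisson P Φ lam) (ω : Ω) :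
    h.kernel ω = pointMeasure (Φ ω) := rfl

-- The number of points in an annulus is finite but not uniformly bounded in `ω`. Splitting further
-- by the exact count `k` gives countably many kernels, each of mass at most `k`.
open Classical in
instance IsHomogeneousPoisson.isSFiniteKernel (h : IsHomogeneousPoisson P Φ lam) :
    IsSFiniteKernel h.kernel := by
  have hm : ∀ n k : ℕ, MeasurableSet {ω | (Φ ω ∩ annulus n).ncard = k} := fun n k =>
    h.measurable_count _ (measurableSet_annulus n) (isBounded_annulus n) (measurableSet_singleton k)
  let κ : ℕ × ℕ → Kernel Ω E3 := fun p =>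
    Kernel.piecewise (hm p.1 p.2) (h.kernel.restrict (measurableSet_annulus p.1)) 0
  have hfin : ∀ p, IsFiniteKernel (κ p) := fun p => by
    refine ⟨⟨p.2, by simp, fun ω => ?_⟩⟩
    simp only [κ, Kernel.piecewise_apply]
    split_ifs with hω
    · rw [Kernel.restrict_apply, Measure.restrict_apply_univ, h.kernel_apply,
        pointMeasure_apply_eq_ncard (measurableSet_annulus _)
          (h.locallyFinite ω _ (isBounded_annulus _))]
      exact le_of_eq (by rw [hω])
    · simp
  have hsum : h.kernel = Kernel.sum κ := by
    ext ω s hs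
    rw [Kernel.sum_apply' _ _ hs, ENNReal.tsum_prod (f := fun n k => κ (n, k) ω s)]
    conv_lhs => rw [← Set.inter_univ s, ← iUnion_annulus, Set.inter_iUnion]
    rw [measure_iUnion]
    · refine tsum_congr fun n => ?_
      rw [tsum_eq_single (Φ ω ∩ annulus n).ncard]
      · simp [κ, Kernel.piecewise_apply, Kernel.restrict_apply, Measure.restrict_apply hs]
      · intro k hk
        simp [κ, Kernel.piecewise_apply, hk.symm]
    · intro m n hmn
      exact (pairwise_disjoint_annulus hmn).mono Set.inter_subset_right Set.inter_subset_right
    · exact fun n => hs.inter (measurableSet_annulus n)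
  rw [hsum]
  infer_instance

/-! ### Moments of Poisson counts. -/

/-- Size-biasing: `n * r ^ n / n!` is `r` times the weight of `n - 1`. Both moments needed below
follow from it. -/
lemma lintegral_natCast_mul_poissonMeasure (r : ℝ≥0) (f : ℕ → ℝ≥0∞) :
    ∫⁻ n, n * f n ∂poissonMeasure r = r * ∫⁻ n, f (n + 1) ∂poissonMeasure r := by
  simp only [poissonMeasure, lintegral_sum_measure, lintegral_smul_measure, lintegral_dirac,
    smul_eq_mul]
  rw [tsum_eq_zero_add' ENNReal.summable, ← ENNReal.tsum_mul_left]
  simp only [Nat.cast_zero, zero_mul, mul_zero, zero_add]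
  refine tsum_congr fun n => ?_
  rw [← mul_assoc, ← mul_assoc]
  congr 1
  rw [← ENNReal.ofReal_natCast, ← ENNReal.ofReal_coe_nnreal, ← ENNReal.ofReal_mul (by positivity),
    ← ENNReal.ofReal_mul (by positivity)]
  congr 1
  rw [Nat.factorial_succ]
  push_cast
  field_simp
  ring

lemma lintegral_natCast_poissonMeasure (r : ℝ≥0) : ∫⁻ n, (n : ℝ≥0∞) ∂poissonMeasure r = r := by
  simpa using lintegral_natCast_mul_poissonMeasure r fun _ => 1

lemma lintegral_natCast_mul_self_poissonMeasure (r : ℝ≥0) :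
    ∫⁻ n, (n * n : ℝ≥0∞) ∂poissonMeasure r = r * (r + 1) := by
  rw [lintegral_natCast_mul_poissonMeasure r fun n => (n : ℝ≥0∞)]
  simp only [Nat.cast_add, Nat.cast_one]
  rw [lintegral_add_right _ measurable_const, lintegral_natCast_poissonMeasure]
  simp

lemma lintegral_void_poissonMeasure (r : ℝ≥0) :
    ∫⁻ n, (if n = 0 then 1 else 0 : ℝ≥0∞) ∂poissonMeasure r = ENNReal.ofReal (Real.exp (-r)) := by
  have : (fun n : ℕ => (if n = 0 then 1 else 0 : ℝ≥0∞)) = ({0} : Set ℕ).indicator 1 := by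
    ext n; simp [Set.indicator_apply]
  rw [this, lintegral_indicator_one (measurableSet_singleton 0), poissonMeasure_singleton]
  simp

lemma IsHomogeneousPoisson.lintegral_prod_count (h : IsHomogeneousPoisson P Φ lam) {n : ℕ}
    (A : Fin n → Set E3) (hA : ∀ i, MeasurableSet (A i)) (hb : ∀ i, Bornology.IsBounded (A i))
    (hd : Pairwise fun i j => Disjoint (A i) (A j)) (f : Fin n → ℕ → ℝ≥0∞) :
    ∫⁻ ω, ∏ i, f i (Φ ω ∩ A i).ncard ∂P =
      ∏ i, ∫⁻ k, f i k ∂poissonMeasure (lam * (volume (A i)).toReal).toNNReal := by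
  have hind := (h.indep_count n A hA hb hd).comp (fun i => f i) (fun i => measurable_from_top)
  have := lintegral_prod_eq_prod_lintegral_of_indepFun Finset.univ
    (fun i ω => f i (Φ ω ∩ A i).ncard) hind
    (fun i => measurable_from_top.comp (h.measurable_count _ (hA i) (hb i)))
  rw [this]
  refine Finset.prod_congr rfl fun i _ => ?_
  rw [← h.law_count _ (hA i) (hb i), lintegral_map measurable_from_top
    (h.measurable_count _ (hA i) (hb i))]

lemma coe_toNNReal_intensity {lam : ℝ} (hlam : 0 < lam) {s : Set E3}
    (hs : Bornology.IsBounded s) :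
    ((lam * (volume s).toReal).toNNReal : ℝ≥0∞) = ENNReal.ofReal lam * volume s := by
  change ENNReal.ofReal _ = _
  rw [ENNReal.ofReal_mul hlam.le, ENNReal.ofReal_toReal hs.measure_lt_top.ne]

/-- Second moments of the counts of two sets, on the event that a third set is void. -/
lemma IsHomogeneousPoisson.lintegral_void_mul_count_mul_count (h : IsHomogeneousPoisson P Φ lam)
    [IsProbabilityMeasure P]
    (hlam : 0 < lam) {D A B : Set E3} (hD : MeasurableSet D) (hA : MeasurableSet A)
    (hB : MeasurableSet B) (hDb : Bornology.IsBounded D) (hAb : Bornology.IsBounded A)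
    (hBb : Bornology.IsBounded B) (hDA : Disjoint D A) (hDB : Disjoint D B) :
    ∫⁻ ω, (if (Φ ω ∩ D).ncard = 0 then 1 else 0) *
        (pointMeasure (Φ ω) A * pointMeasure (Φ ω) B) ∂P =
      ENNReal.ofReal (Real.exp (-(lam * (volume D).toReal))) *
        (ENNReal.ofReal lam * volume A * (ENNReal.ofReal lam * volume B) +
          ENNReal.ofReal lam * volume (A ∩ B)) := by
  -- Independence requires disjoint sets, so `A` and `B` are broken into atoms.
  let S : Fin 4 → Set E3 := ![D, A ∩ B, A \ B, B \ A]
  have hS : ∀ i, MeasurableSet (S i) := by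
    intro i
    fin_cases i
    exacts [hD, hA.inter hB, hA.diff hB, hB.diff hA]
  have hSb : ∀ i, Bornology.IsBounded (S i) := by
    intro i
    fin_cases i
    exacts [hDb, hAb.subset Set.inter_subset_left, hAb.subset Set.sdiff_subset,
      hBb.subset Set.sdiff_subset]
  have hSd : Pairwise fun i j => Disjoint (S i) (S j) := by
    have e1 : Disjoint D (A ∩ B) := hDA.mono_right Set.inter_subset_left
    have e2 : Disjoint D (A \ B) := hDA.mono_right Set.sdiff_subset
    have e3 : Disjoint D (B \ A) := hDB.mono_right Set.sdiff_subset
    have e4 : Disjoint (A ∩ B) (A \ B) := Set.disjoint_sdiff_inter.symm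
    have e5 : Disjoint (A ∩ B) (B \ A) := by
      rw [Set.inter_comm]; exact Set.disjoint_sdiff_inter.symm
    have e6 : Disjoint (A \ B) (B \ A) := disjoint_sdiff_sdiff
    intro i j hij
    fin_cases i <;> fin_cases j <;> first
      | exact absurd rfl hij
      | assumption
      | (apply Disjoint.symm; assumption)
  set r : Fin 4 → ℝ≥0 := fun i => (lam * (volume (S i)).toReal).toNNReal with hr
  have hr' : ∀ i, (r i : ℝ≥0∞) = ENNReal.ofReal lam * volume (S i) := fun i =>
    coe_toNNReal_intensity hlam (hSb i)
  set N : Fin 4 → Ω → ℕ := fun i ω => (Φ ω ∩ S i).ncard with hN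
  have hNm : ∀ i, Measurable (N i) := fun i => h.measurable_count _ (hS i) (hSb i)
  have hNm' : ∀ i, Measurable fun ω => (N i ω : ℝ≥0∞) := fun i =>
    (measurable_from_top (f := fun k : ℕ => (k : ℝ≥0∞))).comp (hNm i)
  have hpt : ∀ ω i, pointMeasure (Φ ω) (S i) = N i ω := fun ω i =>
    pointMeasure_apply_eq_ncard (hS i) (h.locallyFinite ω _ (hSb i))
  let v : ℕ → ℝ≥0∞ := fun k => if k = 0 then 1 else 0
  let c : ℕ → ℝ≥0∞ := fun k => k
  let q : ℕ → ℝ≥0∞ := fun k => k * k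
  let o : ℕ → ℝ≥0∞ := fun _ => 1
  have hvm : Measurable fun ω => v (N 0 ω) := (measurable_from_top (f := v)).comp (hNm 0)
  have hA' : ∀ ω, pointMeasure (Φ ω) A = N 1 ω + N 2 ω := fun ω => by
    rw [← hpt, ← hpt]
    exact (measure_inter_add_sdiff A hB).symm
  have hB' : ∀ ω, pointMeasure (Φ ω) B = N 1 ω + N 3 ω := fun ω => by
    rw [← hpt, ← hpt]
    change _ = pointMeasure (Φ ω) (A ∩ B) + pointMeasure (Φ ω) (B \ A)
    rw [Set.inter_comm]
    exact (measure_inter_add_sdiff B hA).symm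
  have hvolA : volume A = volume (S 1) + volume (S 2) := (measure_inter_add_sdiff A hB).symm
  have hvolB : volume B = volume (S 1) + volume (S 3) := by
    change _ = volume (A ∩ B) + volume (B \ A)
    rw [Set.inter_comm]
    exact (measure_inter_add_sdiff B hA).symm
  have hcalc : ∀ f : Fin 4 → ℕ → ℝ≥0∞, ∫⁻ ω, ∏ i, f i (N i ω) ∂P =
      ∏ i, ∫⁻ k, f i k ∂poissonMeasure (r i) := fun f =>
    h.lintegral_prod_count S hS hSb hSd f
  -- The four terms of `(N 1 + N 2) * (N 1 + N 3)`, each multiplied by the void indicator. The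
  -- second moment `r * (r + 1)` of `N 1` exceeds `r ^ 2` by `r`, which is the source of the `A ∩ B`
  -- term.
  have t1 := hcalc ![v, q, o, o]
  have t2 := hcalc ![v, c, o, c]
  have t3 := hcalc ![v, c, c, o]
  have t4 := hcalc ![v, o, c, c]
  simp only [Fin.prod_univ_four, Matrix.cons_val, v, c, q, o, lintegral_natCast_poissonMeasure,
    lintegral_natCast_mul_self_poissonMeasure, lintegral_void_poissonMeasure, lintegral_one,
    measure_univ, mul_one] at t1 t2 t3 t4
  have hexp : (r 0 : ℝ) = lam * (volume D).toReal := Real.coe_toNNReal _ (by positivity)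
  have hsplit : ∀ ω, (if (Φ ω ∩ D).ncard = 0 then 1 else 0) *
        (pointMeasure (Φ ω) A * pointMeasure (Φ ω) B) =
      v (N 0 ω) * (N 1 ω * N 1 ω) + v (N 0 ω) * N 1 ω * N 3 ω + v (N 0 ω) * N 1 ω * N 2 ω +
        v (N 0 ω) * N 2 ω * N 3 ω := fun ω => by
    rw [hA', hB']
    change v (N 0 ω) * _ = _
    ring
  simp_rw [hsplit]
  rw [lintegral_add_left, lintegral_add_left, lintegral_add_left, t1, t2, t3, t4, hexp, hvolA,
    hvolB]
  · change _ = _ * (_ + ENNReal.ofReal lam * volume (S 1))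
    simp only [mul_add, ← hr']
    ring
  all_goals fun_prop

end

/-! ### Two-point Mecke formula for fixed and finitely many void sets. -/

/-- The event that a set contains no point of the process. -/
def voidEvent {Ω : Type*} (Φ : Ω → Set E3) (D : Set E3) : Set Ω := {ω | ∀ x ∈ Φ ω, x ∉ D}

lemma voidEvent_eq {Ω : Type*} (Φ : Ω → Set E3) {D : Set E3} (hD : MeasurableSet D) :
    voidEvent Φ D = {ω | pointMeasure (Φ ω) D = 0} := by
  ext ω
  exact (pointMeasure_eq_zero_iff _ hD).symm

section

variable {Ω : Type*} [MeasurableSpace Ω] {P : Measure Ω} {Φ : Ω → Set E3} {lam : ℝ}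

lemma IsHomogeneousPoisson.measurableSet_voidEvent (h : IsHomogeneousPoisson P Φ lam)
    {D : Set E3} (hD : MeasurableSet D) : MeasurableSet (voidEvent Φ D) := by
  rw [voidEvent_eq Φ hD]
  exact (Measure.measurable_coe hD).comp h.measurable_pointMeasure (measurableSet_singleton 0)

/-- The measure of pairs of points of the process, jointly with the underlying outcome. -/
noncomputable def IsHomogeneousPoisson.pairMeasure (h : IsHomogeneousPoisson P Φ lam) :
    Measure (Ω × (E3 × E3)) :=
  P ⊗ₘ (h.kernel ×ₖ h.kernel)

lemma IsHomogeneousPoisson.lintegral_pairMeasure [SFinite P] (h : IsHomogeneousPoisson P Φ lam)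
    {f : Ω × (E3 × E3) → ℝ≥0∞} (hf : Measurable f) :
    ∫⁻ p, f p ∂h.pairMeasure =
      ∫⁻ ω, ∫⁻ u, f (ω, u) ∂((pointMeasure (Φ ω)).prod (pointMeasure (Φ ω))) ∂P := by
  rw [pairMeasure, Measure.lintegral_compProd hf]
  simp_rw [Kernel.prod_apply, h.kernel_apply]

lemma IsHomogeneousPoisson.sFinite_pointMeasure (h : IsHomogeneousPoisson P Φ lam) (ω : Ω) :
    SFinite (pointMeasure (Φ ω)) :=
  inferInstanceAs (SFinite (h.kernel ω))

/-- Two-point Mecke formula for functionals that depend on the configuration only through the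
event that a fixed set is void. -/
lemma IsHomogeneousPoisson.lintegral_pairMeasure_void_const [IsProbabilityMeasure P]
    (h : IsHomogeneousPoisson P Φ lam) (hlam : 0 < lam) {D W : Set E3} (hD : MeasurableSet D)
    (hW : MeasurableSet W) (hDb : Bornology.IsBounded D) (hWb : Bornology.IsBounded W)
    (hDW : Disjoint D W) {g : E3 × E3 → ℝ≥0∞} (hg : Measurable g)
    (hgW : ∀ u ∉ W ×ˢ W, g u = 0) (hdiag : ∀ x, g (x, x) = 0) :
    ∫⁻ p, g p.2 * (voidEvent Φ D).indicator 1 p.1 ∂h.pairMeasure =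
      ENNReal.ofReal (Real.exp (-(lam * (volume D).toReal))) * ENNReal.ofReal lam ^ 2 *
        ∫⁻ u, g u ∂(volume.prod volume) := by
  have hV := h.measurableSet_voidEvent hD
  set e := ENNReal.ofReal (Real.exp (-(lam * (volume D).toReal))) with he
  set l := ENNReal.ofReal lam with hl
  set V := voidEvent Φ D with hVdef
  -- The second moment identity says that these two finite measures agree on rectangles, hence are
  -- equal. The diagonal part of `m₂` accounts for pairs `(x, x)`; it is invisible to `g` because of
  -- `hdiag`.
  let m₁ : Measure (E3 × E3) := (h.pairMeasure.restrict (V ×ˢ (W ×ˢ W))).map Prod.snd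
  let m₂ : Measure (E3 × E3) := ((e * l ^ 2) • volume.prod volume +
    (e * l) • (volume : Measure E3).map fun x => (x, x)).restrict (W ×ˢ W)
  have hrect : ∀ s t : Set E3, MeasurableSet s → MeasurableSet t →
      m₁ (s ×ˢ t) = e * (l * volume (s ∩ W) * (l * volume (t ∩ W)) + l * volume (s ∩ W ∩ (t ∩ W))) := by
    intro s t hs ht
    have hVm : MeasurableSet (V ×ˢ (W ×ˢ W)) := hV.prod (hW.prod hW)
    rw [Measure.map_apply measurable_snd (hs.prod ht),
      Measure.restrict_apply (measurable_snd (hs.prod ht)), pairMeasure,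
      Measure.compProd_apply ((measurable_snd (hs.prod ht)).inter hVm),
      ← h.lintegral_void_mul_count_mul_count hlam hD (hs.inter hW) (ht.inter hW) hDb
        (hWb.subset Set.inter_subset_right) (hWb.subset Set.inter_subset_right)
        (hDW.mono_right Set.inter_subset_right) (hDW.mono_right Set.inter_subset_right)]
    refine lintegral_congr fun ω => ?_
    have := h.sFinite_pointMeasure ω
    rw [Kernel.prod_apply, h.kernel_apply]
    have hiff : (Φ ω ∩ D).ncard = 0 ↔ ω ∈ V := by
      rw [Set.ncard_eq_zero (h.locallyFinite ω D hDb), Set.eq_empty_iff_forall_notMem]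
      simp [hVdef, voidEvent]
    by_cases hω : ω ∈ V
    · rw [if_pos (hiff.2 hω), one_mul, ← Measure.prod_prod]
      congr 1
      ext u
      simp [hω, Set.mem_prod]
      tauto
    · rw [if_neg (mt hiff.1 hω), zero_mul]
      rw [show Prod.mk ω ⁻¹' (Prod.snd ⁻¹' s ×ˢ t ∩ V ×ˢ W ×ˢ W) = ∅ by ext u; simp [hω],
        measure_empty]
  have hm : m₁ = m₂ := by
    have : IsFiniteMeasure m₁ := by
      refine ⟨?_⟩
      rw [← Set.univ_prod_univ, hrect _ _ .univ .univ]
      simp only [Set.univ_inter, Set.inter_self]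
      have := hWb.measure_lt_top (μ := volume)
      finiteness
    refine Measure.ext_prod fun {s t} hs ht => ?_
    rw [hrect s t hs ht, Measure.restrict_apply (hs.prod ht), Set.prod_inter_prod]
    have hd : Measurable fun x : E3 => (x, x) := by fun_prop
    rw [Measure.add_apply, Measure.smul_apply, Measure.smul_apply, Measure.prod_prod,
      Measure.map_apply hd ((hs.inter hW).prod (ht.inter hW)), smul_eq_mul, smul_eq_mul]
    have : (fun x : E3 => (x, x)) ⁻¹' ((s ∩ W) ×ˢ (t ∩ W)) = s ∩ W ∩ (t ∩ W) := rfl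
    rw [this]
    ring
  have h1 : ∫⁻ u, g u ∂m₁ = ∫⁻ p, g p.2 * V.indicator 1 p.1 ∂h.pairMeasure := by
    rw [lintegral_map hg measurable_snd, ← lintegral_indicator (hV.prod (hW.prod hW))]
    refine lintegral_congr fun p => ?_
    by_cases hp1 : p.1 ∈ V <;> by_cases hp2 : p.2 ∈ W ×ˢ W
    · rw [Set.indicator_of_mem (Set.mk_mem_prod hp1 hp2), Set.indicator_of_mem hp1]; simp
    · rw [hgW _ hp2, zero_mul, Set.indicator_apply_eq_zero]
      exact fun hp => absurd hp.2 hp2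
    · rw [Set.indicator_of_notMem hp1, mul_zero, Set.indicator_apply_eq_zero]
      exact fun hp => absurd hp.1 hp1
    · rw [Set.indicator_of_notMem hp1, mul_zero, Set.indicator_apply_eq_zero]
      exact fun hp => absurd hp.1 hp1
  have h2 : ∫⁻ u, g u ∂m₂ = e * l ^ 2 * ∫⁻ u, g u ∂(volume.prod volume) := by
    rw [← lintegral_indicator (hW.prod hW),
      show (W ×ˢ W).indicator g = g from Set.indicator_eq_self.2 fun u hu => by
        by_contra hn; exact hu (hgW u hn),
      lintegral_add_measure, lintegral_smul_measure, lintegral_smul_measure,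
      lintegral_map hg (by fun_prop)]
    simp [hdiag]
  rw [← h1, hm, h2]

/-- The pair space is partitioned according to which of the first `k` conditions `u ∈ C j` hold. On
each of these finitely many cells the void set is constant, so the formula for a fixed set applies
and the results add up. -/
lemma IsHomogeneousPoisson.lintegral_pairMeasure_void_finite [IsProbabilityMeasure P]
    (h : IsHomogeneousPoisson P Φ lam) (hlam : 0 < lam) {V : ℕ → Set E3} {C : ℕ → Set (E3 × E3)}
    (hV : ∀ j, MeasurableSet (V j)) (hVb : ∀ j, Bornology.IsBounded (V j))
    (hC : ∀ j, MeasurableSet (C j)) {W : Set E3}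
    (hW : MeasurableSet W) (hWb : Bornology.IsBounded W)
    {g : E3 × E3 → ℝ≥0∞} (hg : Measurable g)
    (hgW : ∀ u ∉ W ×ˢ W, g u = 0) (hdiag : ∀ x, g (x, x) = 0)
    (hVC : ∀ u, g u ≠ 0 → ∀ j, u ∈ C j → u.1 ∉ V j ∧ u.2 ∉ V j) (k : ℕ) :
    ∫⁻ p, g p.2 * (voidEvent Φ (⋃ j < k, ⋃ (_ : p.2 ∈ C j), V j)).indicator 1 p.1 ∂h.pairMeasure =
      ENNReal.ofReal lam ^ 2 * ∫⁻ u, g u *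
        ENNReal.ofReal (Real.exp (-(lam * (volume (⋃ j < k, ⋃ (_ : u ∈ C j), V j)).toReal)))
          ∂(volume.prod volume) := by
  classical
  let cell : Finset ℕ → Set (E3 × E3) := fun S => {u | ∀ j < k, u ∈ C j ↔ j ∈ S}
  let D : Finset ℕ → Set E3 := fun S => ⋃ j ∈ S, V j
  have hcell : ∀ S, MeasurableSet (cell S) := by
    intro S
    have : cell S = ⋂ j, ⋂ (_ : j < k), {u | u ∈ C j ↔ j ∈ S} := by
      ext u; simp [cell]
    rw [this]
    refine MeasurableSet.iInter fun j => MeasurableSet.iInter fun _ => ?_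
    by_cases hj : j ∈ S
    · simpa [hj] using hC j
    · simp only [hj, iff_false]
      exact (hC j).compl
  have hD : ∀ S, MeasurableSet (D S) := fun S => S.measurableSet_biUnion fun j _ => hV j
  have hDb : ∀ S, Bornology.IsBounded (D S) := fun S =>
    (Bornology.isBounded_biUnion_finset S).2 fun j _ => hVb j
  let type : E3 × E3 → Finset ℕ := fun u => (Finset.range k).filter fun j => u ∈ C j
  have htype : ∀ u, u ∈ cell (type u) := fun u j hj => by simp [type, hj]
  have htype' : ∀ u, type u ∈ (Finset.range k).powerset := fun u =>
    Finset.mem_powerset.2 (Finset.filter_subset _ _)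
  have huniq : ∀ u, ∀ S ∈ (Finset.range k).powerset, u ∈ cell S → S = type u := by
    intro u S hS hu
    rw [Finset.mem_powerset] at hS
    ext j
    simp only [type, Finset.mem_filter, Finset.mem_range]
    constructor
    · intro hj
      have := Finset.mem_range.1 (hS hj)
      exact ⟨this, (hu j this).2 hj⟩
    · exact fun hj => (hu j hj.1).1 hj.2
  have hDu : ∀ u, (⋃ j < k, ⋃ (_ : u ∈ C j), V j) = D (type u) := by
    intro u
    ext x
    simp only [D, type, Set.mem_iUnion, Finset.mem_filter, Finset.mem_range, exists_prop]
    exact exists_congr fun j => and_assoc.symm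
  have hdecomp : ∀ (u : E3 × E3) (F : Finset ℕ → ℝ≥0∞), g u * F (type u) =
      ∑ S ∈ (Finset.range k).powerset, (cell S).indicator g u * F S := by
    intro u F
    rw [Finset.sum_eq_single (type u)]
    · rw [Set.indicator_of_mem (htype u)]
    · intro S hS hne
      rw [Set.indicator_of_notMem fun hu => hne (huniq u S hS hu), zero_mul]
    · exact fun hn => absurd (htype' u) hn
  have hl : ∀ p : Ω × (E3 × E3), g p.2 *
      (voidEvent Φ (⋃ j < k, ⋃ (_ : p.2 ∈ C j), V j)).indicator 1 p.1 =
      ∑ S ∈ (Finset.range k).powerset,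
        (cell S).indicator g p.2 * (voidEvent Φ (D S)).indicator 1 p.1 := by
    intro p
    rw [← hdecomp p.2 fun S => (voidEvent Φ (D S)).indicator 1 p.1]
    simp only [hDu]
  have hr : ∀ u : E3 × E3, g u *
        ENNReal.ofReal (Real.exp (-(lam * (volume (⋃ j < k, ⋃ (_ : u ∈ C j), V j)).toReal))) =
      ∑ S ∈ (Finset.range k).powerset, (cell S).indicator g u *
        ENNReal.ofReal (Real.exp (-(lam * (volume (D S)).toReal))) := by
    intro u
    rw [← hdecomp u fun S => ENNReal.ofReal (Real.exp (-(lam * (volume (D S)).toReal))), hDu]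
  simp_rw [hl, hr]
  rw [lintegral_finsetSum, lintegral_finsetSum, Finset.mul_sum]
  · refine Finset.sum_congr rfl fun S hS => ?_
    have hSk : ∀ j ∈ S, j < k := fun j hj =>
      Finset.mem_range.1 (Finset.mem_powerset.1 hS hj)
    -- The window is shrunk to `W \ D S` to be disjoint from the void set; by `hVC` the integrand on
    -- this cell already vanishes outside it.
    rw [h.lintegral_pairMeasure_void_const hlam (hD S) (hW.diff (hD S)) (hDb S)
      (hWb.subset Set.sdiff_subset) Set.disjoint_sdiff_right (hg.indicator (hcell S)),
      lintegral_mul_const _ (hg.indicator (hcell S))]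
    · ring
    · intro u hu
      by_contra hne
      rw [Set.indicator_apply_eq_zero, Classical.not_imp] at hne
      obtain ⟨huS, hgu⟩ := hne
      have huW : u ∈ W ×ˢ W := by
        by_contra hn; exact hgu (hgW u hn)
      refine hu ⟨⟨huW.1, ?_⟩, ⟨huW.2, ?_⟩⟩
      · simp only [D, Set.mem_iUnion, not_exists]
        exact fun j hj => (hVC u hgu j ((huS j (hSk j hj)).2 hj)).1
      · simp only [D, Set.mem_iUnion, not_exists]
        exact fun j hj => (hVC u hgu j ((huS j (hSk j hj)).2 hj)).2
    · intro x
      simp [Set.indicator_apply, hdiag]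
  · exact fun S _ => (hg.indicator (hcell S)).mul_const _
  · intro S _
    exact ((hg.indicator (hcell S)).comp measurable_snd).mul
      ((measurable_one.indicator (h.measurableSet_voidEvent (hD S))).comp measurable_fst)

end

/-! ### Passage to void balls that move with the pair. -/

section

open Filter Topology

variable {Ω : Type*} [MeasurableSpace Ω] {P : Measure Ω} {Φ : Ω → Set E3} {lam : ℝ}

lemma IsHomogeneousPoisson.measurable_indicator_voidEvent (h : IsHomogeneousPoisson P Φ lam)
    {ι T : Type*} [Countable ι] [MeasurableSpace T] {V : ι → Set E3} {C : ι → Set T}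
    (hV : ∀ j, MeasurableSet (V j)) (hC : ∀ j, MeasurableSet (C j)) :
    Measurable fun p : Ω × T => ((voidEvent Φ (⋃ j, ⋃ (_ : p.2 ∈ C j), V j)).indicator 1 p.1 :
      ℝ≥0∞) := by
  refine (measurable_one (α := ℝ≥0∞)).indicator
    (s := {p : Ω × T | p.1 ∈ voidEvent Φ (⋃ j, ⋃ (_ : p.2 ∈ C j), V j)}) ?_
  have : {p : Ω × T | p.1 ∈ voidEvent Φ (⋃ j, ⋃ (_ : p.2 ∈ C j), V j)} =
      ⋂ j, (Prod.snd ⁻¹' (C j)ᶜ ∪ Prod.fst ⁻¹' voidEvent Φ (V j)) := by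
    ext p
    simp only [voidEvent, Set.mem_ofPred_eq, Set.mem_iUnion, Set.mem_iInter, Set.mem_union,
      Set.mem_preimage, Set.mem_compl_iff, exists_prop, not_exists, not_and]
    constructor
    · intro hp j
      by_cases hj : p.2 ∈ C j
      · exact Or.inr fun x hx => hp x hx j hj
      · exact Or.inl hj
    · intro hp x hx j hj
      exact (hp j).resolve_left (not_not.2 hj) x hx
  rw [this]
  exact MeasurableSet.iInter fun j => (measurable_snd (hC j).compl).union
    (measurable_fst (h.measurableSet_voidEvent (hV j)))

/-- The union is the section at `u` of the measurable set `⋃ j, C j ×ˢ V j`. -/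
lemma measurable_volume_iUnion {ι : Type*} [Countable ι] {V : ι → Set E3} {C : ι → Set (E3 × E3)}
    (hV : ∀ j, MeasurableSet (V j)) (hC : ∀ j, MeasurableSet (C j)) :
    Measurable fun u => volume (⋃ j, ⋃ (_ : u ∈ C j), V j) := by
  have : MeasurableSet (⋃ j, C j ×ˢ V j) := MeasurableSet.iUnion fun j => (hC j).prod (hV j)
  convert measurable_measure_prodMk_left (ν := (volume : Measure E3)) this using 3
  ext x
  simp

/-- Dominated convergence on both sides as `k → ∞`, with `g` as dominating function. The indicators
on the left are eventually constant; on the right the volumes converge by continuity from below. -/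
lemma IsHomogeneousPoisson.lintegral_pairMeasure_void_iUnion [IsProbabilityMeasure P]
    (h : IsHomogeneousPoisson P Φ lam) (hlam : 0 < lam) {V : ℕ → Set E3} {C : ℕ → Set (E3 × E3)}
    (hV : ∀ j, MeasurableSet (V j)) (hVb : ∀ j, Bornology.IsBounded (V j))
    (hC : ∀ j, MeasurableSet (C j)) {W : Set E3}
    (hW : MeasurableSet W) (hWb : Bornology.IsBounded W)
    {g : E3 × E3 → ℝ≥0∞} (hg : Measurable g)
    (hgW : ∀ u ∉ W ×ˢ W, g u = 0) (hdiag : ∀ x, g (x, x) = 0)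
    (hVC : ∀ u, g u ≠ 0 → ∀ j, u ∈ C j → u.1 ∉ V j ∧ u.2 ∉ V j)
    (hD : ∀ u, volume (⋃ j, ⋃ (_ : u ∈ C j), V j) ≠ ⊤)
    (hfin : ∫⁻ u, g u ∂(volume.prod volume) ≠ ⊤) :
    ∫⁻ p, g p.2 * (voidEvent Φ (⋃ j, ⋃ (_ : p.2 ∈ C j), V j)).indicator 1 p.1
      ∂h.pairMeasure =
      ENNReal.ofReal lam ^ 2 * ∫⁻ u, g u *
        ENNReal.ofReal (Real.exp (-(lam * (volume (⋃ j, ⋃ (_ : u ∈ C j), V j)).toReal)))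
          ∂(volume.prod volume) := by
  have hk := h.lintegral_pairMeasure_void_finite hlam hV hVb hC hW hWb hg hgW hdiag hVC
  have hre : ∀ (u : E3 × E3) (k : ℕ), (⋃ j < k, ⋃ (_ : u ∈ C j), V j) =
      ⋃ j : Fin k, ⋃ (_ : u ∈ C j), V j := by
    intro u k
    ext x
    simp only [Set.mem_iUnion, exists_prop, Fin.exists_iff]
  -- The case `k = 0`, with empty void set, shows that the dominating function is integrable.
  have hfin' : ∫⁻ p, g p.2 ∂h.pairMeasure ≠ ⊤ := by
    have h0 := hk 0
    simp only [not_lt_zero, Set.iUnion_of_empty, Set.iUnion_empty, measure_empty,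
      ENNReal.toReal_zero, mul_zero, neg_zero, Real.exp_zero, ENNReal.ofReal_one, mul_one,
      voidEvent, Set.mem_empty_iff_false, not_false_eq_true, implies_true, Set.ofPred_true,
      Set.indicator_univ, Pi.one_apply] at h0
    rw [h0]
    finiteness
  have hgs : Measurable fun p : Ω × (E3 × E3) => g p.2 := hg.comp measurable_snd
  have hleft : Tendsto (fun k => ∫⁻ p, g p.2 *
        (voidEvent Φ (⋃ j < k, ⋃ (_ : p.2 ∈ C j), V j)).indicator 1 p.1 ∂h.pairMeasure) atTop
      (𝓝 (∫⁻ p, g p.2 * (voidEvent Φ (⋃ j, ⋃ (_ : p.2 ∈ C j), V j)).indicator 1 p.1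
        ∂h.pairMeasure)) := by
    refine tendsto_lintegral_of_dominated_convergence (fun p => g p.2) (fun k => ?_) (fun k => ?_)
      hfin' ?_
    · simp_rw [hre]
      exact hgs.mul (h.measurable_indicator_voidEvent (fun j => hV j) fun j => hC j)
    · refine Eventually.of_forall fun p => ?_
      refine mul_le_of_le_one_right' ?_
      exact Set.indicator_le_self (M := ℝ≥0∞) _ _ _
    · refine Eventually.of_forall fun p => tendsto_const_nhds.congr' ?_
      by_cases hp : p.1 ∈ voidEvent Φ (⋃ j, ⋃ (_ : p.2 ∈ C j), V j)
      · refine Eventually.of_forall fun k => ?_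
        have hpk : p.1 ∈ voidEvent Φ (⋃ j < k, ⋃ (_ : p.2 ∈ C j), V j) := by
          intro x hx hn
          refine hp x hx ?_
          simp only [Set.mem_iUnion, exists_prop] at hn ⊢
          obtain ⟨j, -, hj⟩ := hn
          exact ⟨j, hj⟩
        simp only [Set.indicator_of_mem hp, Set.indicator_of_mem hpk]
      · have hp' := hp
        simp only [voidEvent, Set.mem_ofPred_eq, Set.mem_iUnion, exists_prop, not_forall,
          not_not] at hp'
        obtain ⟨x, hx, j, hj, hxj⟩ := hp'
        filter_upwards [eventually_gt_atTop j] with k hjk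
        rw [Set.indicator_of_notMem hp, Set.indicator_of_notMem]
        intro hn
        refine hn x hx ?_
        simp only [Set.mem_iUnion, exists_prop]
        exact ⟨j, hjk, hj, hxj⟩
  have hright : Tendsto (fun k => ∫⁻ u, g u *
        ENNReal.ofReal (Real.exp (-(lam * (volume (⋃ j < k, ⋃ (_ : u ∈ C j), V j)).toReal)))
          ∂(volume.prod volume)) atTop
      (𝓝 (∫⁻ u, g u *
        ENNReal.ofReal (Real.exp (-(lam * (volume (⋃ j, ⋃ (_ : u ∈ C j), V j)).toReal)))
          ∂(volume.prod volume))) := by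
    refine tendsto_lintegral_of_dominated_convergence g (fun k => ?_) (fun k => ?_) hfin ?_
    · simp_rw [hre]
      have := measurable_volume_iUnion (ι := Fin k) (fun j => hV j) fun j => hC j
      fun_prop
    · refine Eventually.of_forall fun u => mul_le_of_le_one_right' ?_
      rw [← ENNReal.ofReal_one]
      refine ENNReal.ofReal_le_ofReal (Real.exp_le_one_iff.2 ?_)
      have : 0 ≤ lam * (volume (⋃ j < k, ⋃ (_ : u ∈ C j), V j)).toReal := by positivity
      linarith
    · refine Eventually.of_forall fun u => ?_
      refine ENNReal.Tendsto.const_mul ?_ (Or.inl ?_)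
      · have hmono : Monotone fun k => ⋃ j < k, ⋃ (_ : u ∈ C j), V j := by
          intro a b hab
          refine Set.iUnion_mono fun j => Set.iUnion_mono' fun hj => ⟨hj.trans_le hab, le_rfl⟩
        have hU : (⋃ k, ⋃ j < k, ⋃ (_ : u ∈ C j), V j) = ⋃ j, ⋃ (_ : u ∈ C j), V j := by
          ext x
          simp only [Set.mem_iUnion, exists_prop]
          exact ⟨fun ⟨k, j, _, hj⟩ => ⟨j, hj⟩, fun ⟨j, hj⟩ => ⟨j + 1, j, j.lt_succ_self, hj⟩⟩
        have hlim := tendsto_measure_iUnion_atTop (μ := (volume : Measure E3)) hmono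
        rw [hU] at hlim
        have hlim' := (ENNReal.tendsto_toReal (hD u)).comp hlim
        exact ENNReal.tendsto_ofReal (Real.continuous_exp.continuousAt.tendsto.comp
          (hlim'.const_mul lam).neg)
      · simp [Real.exp_pos]
  refine tendsto_nhds_unique hleft ?_
  simp_rw [hk]
  exact ENNReal.Tendsto.const_mul hright (Or.inr (by finiteness))

/-- A ball whose centre and radius depend measurably on a parameter is a countable union of fixed
balls, each of them present for a measurable set of parameters. -/
lemma exists_ball_eq_iUnion {U : Type*} [MeasurableSpace U] {z : U → E3} {R : U → ℝ}
    (hz : Measurable z) (hR : Measurable R) :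
    ∃ (V : ℕ → Set E3) (C : ℕ → Set U), (∀ j, MeasurableSet (V j)) ∧
      (∀ j, Bornology.IsBounded (V j)) ∧ (∀ j, MeasurableSet (C j)) ∧
      ∀ u, Metric.ball (z u) (R u) = ⋃ j, ⋃ (_ : u ∈ C j), V j := by
  obtain ⟨e, he⟩ := exists_surjective_nat (ℕ × ℚ)
  let q := TopologicalSpace.denseSeq E3
  refine ⟨fun j => Metric.ball (q (e j).1) (e j).2,
    -- The triangle inequality makes this condition sufficient for the fixed ball to lie in the
    -- moving one.
    fun j => {u | dist (q (e j).1) (z u) + (e j).2 ≤ R u}, fun j => measurableSet_ball,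
    fun j => Metric.isBounded_ball, fun j => ?_, fun u => ?_⟩
  · exact measurableSet_le (by fun_prop) hR
  · ext x
    simp only [Set.mem_iUnion, exists_prop, Set.mem_ofPred_eq]
    constructor
    · intro hx
      rw [Metric.mem_ball] at hx
      -- The radius is used twice: to reach `x` from the dense point `q i`, and as the radius of the
      -- ball around `q i`. Hence the division by 2.
      obtain ⟨r, hr0, hr1⟩ := exists_rat_btwn (show (0 : ℝ) < (R u - dist x (z u)) / 2 by linarith)
      obtain ⟨i, hi⟩ := Metric.denseRange_iff.1 (TopologicalSpace.denseRange_denseSeq E3) x r hr0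
      obtain ⟨j, hj⟩ := he (i, r)
      refine ⟨j, ?_, ?_⟩
      · rw [hj]
        have := dist_triangle (q i) x (z u)
        rw [dist_comm] at hi
        change dist (q i) (z u) + r ≤ R u
        change dist (q i) x < r at hi
        linarith
      · rw [hj]
        exact hi
    · rintro ⟨j, hj, hxj⟩
      rw [Metric.mem_ball] at hxj ⊢
      have := dist_triangle x (q (e j).1) (z u)
      linarith

lemma IsHomogeneousPoisson.measurable_indicator_voidEvent_ball
    (h : IsHomogeneousPoisson P Φ lam) {T : Type*} [MeasurableSpace T] {z : T → E3} {R : T → ℝ}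
    (hz : Measurable z) (hR : Measurable R) :
    Measurable fun p : Ω × T =>
      ((voidEvent Φ (Metric.ball (z p.2) (R p.2))).indicator 1 p.1 : ℝ≥0∞) := by
  obtain ⟨V, C, hV, -, hC, hball⟩ := exists_ball_eq_iUnion hz hR
  simp_rw [hball]
  exact h.measurable_indicator_voidEvent hV hC

/-- Two-point Mecke formula for the void event of a ball that depends on the two points, and whose
interior contains neither of them. -/
theorem IsHomogeneousPoisson.lintegral_pairMeasure_void_ball [IsProbabilityMeasure P]
    (h : IsHomogeneousPoisson P Φ lam) (hlam : 0 < lam) {z : E3 × E3 → E3} {R : E3 × E3 → ℝ}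
    (hz : Measurable z) (hR : Measurable R) {g : E3 × E3 → ℝ≥0∞} (hg : Measurable g)
    (hdiag : ∀ x, g (x, x) = 0)
    (hzR : ∀ u, g u ≠ 0 → R u ≤ dist u.1 (z u) ∧ R u ≤ dist u.2 (z u)) :
    ∫⁻ p, g p.2 * (voidEvent Φ (Metric.ball (z p.2) (R p.2))).indicator 1 p.1 ∂h.pairMeasure =
      ENNReal.ofReal lam ^ 2 * ∫⁻ u, g u *
        ENNReal.ofReal (Real.exp (-(lam * (volume (Metric.ball (z u) (R u))).toReal)))
          ∂(volume.prod volume) := by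
  obtain ⟨V, C, hV, hVb, hC, hball⟩ := exists_ball_eq_iUnion hz hR
  have hset := h.measurable_indicator_voidEvent hV hC
  have hvol := measurable_volume_iUnion hV hC
  simp_rw [hball]
  let W : ℕ → Set E3 := fun n => Metric.ball 0 n
  -- Truncation in space and in height makes the integral finite; monotone convergence removes it at
  -- the end.
  let G : ℕ → E3 × E3 → ℝ≥0∞ := fun n => (W n ×ˢ W n).indicator fun u => min (g u) n
  have hWm : ∀ n, MeasurableSet (W n ×ˢ W n) := fun n => measurableSet_ball.prod measurableSet_ball
  have hG : ∀ n, Measurable (G n) := fun n => (hg.min measurable_const).indicator (hWm n)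
  have hGg : ∀ n u, G n u ≠ 0 → g u ≠ 0 := by
    intro n u hn hg0
    refine hn ?_
    simp [G, hg0]
  have hGmono : Monotone G := by
    intro m n hmn u
    have hWW : W m ×ˢ W m ⊆ W n ×ˢ W n := by
      have := Metric.ball_subset_ball (x := (0 : E3)) (Nat.cast_le (α := ℝ).2 hmn)
      exact Set.prod_mono this this
    by_cases hu : u ∈ W m ×ˢ W m
    · simp only [G, Set.indicator_of_mem hu, Set.indicator_of_mem (hWW hu)]
      gcongr
    · simp [G, Set.indicator_of_notMem hu]
  have hGsup : ∀ u, ⨆ n, G n u = g u := by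
    intro u
    refine iSup_eq_of_tendsto (fun m n hmn => hGmono hmn u) ?_
    have h1 : Tendsto (fun n : ℕ => min (g u) (n : ℝ≥0∞)) atTop (𝓝 (min (g u) ⊤)) :=
      tendsto_const_nhds.min ENNReal.tendsto_nat_nhds_top
    rw [min_top_right] at h1
    refine h1.congr' ?_
    obtain ⟨N, hN⟩ := exists_nat_gt (max ‖u.1‖ ‖u.2‖)
    filter_upwards [eventually_ge_atTop N] with n hn
    have hn' : (N : ℝ) ≤ n := Nat.cast_le.2 hn
    have hu : u ∈ W n ×ˢ W n := by
      rw [max_lt_iff] at hN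
      constructor
      · exact mem_ball_zero_iff.2 (hN.1.trans_le hn')
      · exact mem_ball_zero_iff.2 (hN.2.trans_le hn')
    simp only [G, Set.indicator_of_mem hu]
  have key : ∀ n, _ := fun n => h.lintegral_pairMeasure_void_iUnion hlam hV hVb hC
    (W := W n) measurableSet_ball Metric.isBounded_ball (hG n)
    (fun u hu => Set.indicator_of_notMem hu _)
    (fun x => by
      by_contra hne
      exact hGg n _ hne (hdiag x))
    (fun u hu j hj => by
      have hsub : V j ⊆ Metric.ball (z u) (R u) := by
        rw [hball]
        exact Set.subset_iUnion₂ (s := fun j (_ : u ∈ C j) => V j) j hj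
      have := hzR u (hGg n u hu)
      constructor
      · exact fun hn => absurd (Metric.mem_ball.1 (hsub hn)) (not_lt.2 this.1)
      · exact fun hn => absurd (Metric.mem_ball.1 (hsub hn)) (not_lt.2 this.2))
    (fun u => by
      rw [← hball]
      exact measure_ball_lt_top.ne)
    (by
      refine ne_top_of_le_ne_top (b := ∫⁻ u, (W n ×ˢ W n).indicator (fun _ => (n : ℝ≥0∞)) u
        ∂(volume.prod volume)) ?_ (lintegral_mono fun u => ?_)
      · rw [lintegral_indicator_const (hWm n), Measure.prod_prod]
        have : volume (W n) < ⊤ := measure_ball_lt_top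
        finiteness
      · exact Set.indicator_le_indicator (min_le_right _ _))
  have hL : ∀ p : Ω × (E3 × E3),
      g p.2 * (voidEvent Φ (⋃ j, ⋃ (_ : p.2 ∈ C j), V j)).indicator 1 p.1 =
        ⨆ n, G n p.2 * (voidEvent Φ (⋃ j, ⋃ (_ : p.2 ∈ C j), V j)).indicator 1 p.1 := fun p => by
    rw [← ENNReal.iSup_mul, hGsup]
  have hR' : ∀ u : E3 × E3, g u *
        ENNReal.ofReal (Real.exp (-(lam * (volume (⋃ j, ⋃ (_ : u ∈ C j), V j)).toReal))) =
      ⨆ n, G n u *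
        ENNReal.ofReal (Real.exp (-(lam * (volume (⋃ j, ⋃ (_ : u ∈ C j), V j)).toReal))) :=
    fun u => by rw [← ENNReal.iSup_mul, hGsup]
  simp_rw [hL, hR']
  rw [lintegral_iSup, lintegral_iSup, ENNReal.mul_iSup]
  · exact iSup_congr key
  · intro n
    have := hG n
    fun_prop
  · intro m n hmn u
    exact mul_le_mul_left (hGmono hmn u) _
  · intro n
    exact ((hG n).comp measurable_snd).mul hset
  · intro m n hmn p
    exact mul_le_mul_left (hGmono hmn p.2) _

end

/-! ### Length on a circle. -/

open Filter Topology

/-- The point with cylindrical coordinates `(ρ, t, b)`. -/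
noncomputable def circlePoint (ρ b t : ℝ) : E3 := !₂[ρ * Real.cos t, ρ * Real.sin t, b]

lemma dist_circlePoint {ρ : ℝ} (hρ : 0 ≤ ρ) (b x y : ℝ) :
    dist (circlePoint ρ b x) (circlePoint ρ b y) = 2 * ρ * |Real.sin ((x - y) / 2)| := by
  rw [EuclideanSpace.dist_eq, Real.sqrt_eq_iff_eq_sq (by positivity) (by positivity)]
  simp only [circlePoint, Real.dist_eq, sq_abs, Fin.sum_univ_three, PiLp.toLp_apply,
    Matrix.cons_val, mul_pow]
  rw [Real.sin_sq_eq_half_sub, show 2 * ((x - y) / 2) = x - y by ring, Real.cos_sub]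
  linear_combination ρ ^ 2 * Real.sin_sq_add_cos_sq x + ρ ^ 2 * Real.sin_sq_add_cos_sq y

lemma continuous_circlePoint (ρ b : ℝ) : Continuous (circlePoint ρ b) := by
  unfold circlePoint
  refine (PiLp.continuous_toLp 2 _).comp (continuous_pi fun i => ?_)
  fin_cases i <;> simp <;> fun_prop

lemma lipschitzWith_circlePoint {ρ : ℝ} (hρ : 0 ≤ ρ) (b : ℝ) :
    LipschitzWith ρ.toNNReal (circlePoint ρ b) := by
  refine LipschitzWith.of_dist_le_mul fun x y => ?_
  rw [dist_circlePoint hρ, Real.coe_toNNReal _ hρ, Real.dist_eq]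
  have : |Real.sin ((x - y) / 2)| ≤ |(x - y) / 2| := Real.abs_sin_le_abs
  rw [abs_div, abs_two] at this
  nlinarith

lemma injOn_circlePoint {ρ : ℝ} (hρ : 0 < ρ) (b : ℝ) :
    Set.InjOn (circlePoint ρ b) (Set.Ioc (-Real.pi) Real.pi) := by
  intro x hx y hy hxy
  have h0 : ρ * Real.cos x = ρ * Real.cos y := congrArg (fun v : E3 => v 0) hxy
  have h1 : ρ * Real.sin x = ρ * Real.sin y := congrArg (fun v : E3 => v 1) hxy
  have h0' := mul_left_cancel₀ hρ.ne' h0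
  have h1' := mul_left_cancel₀ hρ.ne' h1
  rw [← Complex.arg_cos_add_sin_mul_I hx, ← Complex.arg_cos_add_sin_mul_I hy,
    ← Complex.ofReal_cos, ← Complex.ofReal_sin, ← Complex.ofReal_cos, ← Complex.ofReal_sin, h0', h1']

/-- A short chord is almost as long as its arc, by the cubic lower bound for the sine. This makes
the inverse of the parametrization Lipschitz on short arcs. -/
lemma dist_circlePoint_ge {ρ ε : ℝ} (hρ : 0 ≤ ρ) (b : ℝ) {x y : ℝ}
    (hxy : |x - y| ≤ ε) :
    ρ * (1 - ε ^ 2) * |x - y| ≤ dist (circlePoint ρ b x) (circlePoint ρ b y) := by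
  rw [dist_circlePoint hρ]
  have key : ∀ u : ℝ, 0 ≤ u → u ≤ ε → (1 - ε ^ 2) * u ≤ 2 * Real.sin (u / 2) := by
    intro u hu huε
    rcases hu.eq_or_lt with rfl | hu
    · simp
    have := Real.sin_gt_sub_cube (x := u / 2) (by positivity)
    have h2 : u ^ 2 ≤ ε ^ 2 := by gcongr
    nlinarith [mul_le_mul_of_nonneg_left h2 hu.le, pow_pos hu 3]
  have h1 := key |x - y| (abs_nonneg _) hxy
  have h2 : Real.sin (|x - y| / 2) ≤ |Real.sin ((x - y) / 2)| := by
    rcases abs_cases (x - y) with ⟨h, -⟩ | ⟨h, -⟩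
    · rw [h]; exact le_abs_self _
    · rw [h, neg_div, Real.sin_neg]; exact neg_le_abs _
  nlinarith

/-- The length of a subset of a circle is the radius times the measure of the set of angles. -/
lemma hausdorffMeasure_image_circlePoint {ρ : ℝ} (hρ : 0 < ρ) (b : ℝ) {A : Set ℝ}
    (hA : MeasurableSet A) (hAs : A ⊆ Set.Ioc (-Real.pi) Real.pi) :
    Measure.hausdorffMeasure 1 (circlePoint ρ b '' A) = ENNReal.ofReal ρ * volume A := by
  refine le_antisymm ?_ ?_
  · have := (lipschitzWith_circlePoint hρ.le b).hausdorffMeasure_image_le zero_le_one A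
    rw [hausdorffMeasure_real, ENNReal.rpow_one] at this
    exact this
  have hε : ∀ ε : ℝ, 0 < ε → ε < 1 → ENNReal.ofReal (ρ * (1 - ε ^ 2)) * volume A ≤
      Measure.hausdorffMeasure 1 (circlePoint ρ b '' A) := by
    intro ε hε0 hε1
    have hc : 0 < ρ * (1 - ε ^ 2) := mul_pos hρ (by nlinarith)
    -- The lower chord bound holds only for close angles, so `A` is cut into pieces of width `ε`;
    -- injectivity keeps their images disjoint, so the lengths add up.
    let I : ℤ → Set ℝ := fun n => Set.Ioc (n • ε) ((n + 1) • ε)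
    have hI : ⋃ n, I n = Set.univ := iUnion_Ioc_zsmul hε0
    have hId : Pairwise (Function.onFun Disjoint I) := Set.pairwise_disjoint_Ioc_zsmul ε
    have hinj := (injOn_circlePoint hρ b).mono hAs
    have hpiece : ∀ n, ENNReal.ofReal (ρ * (1 - ε ^ 2)) * volume (A ∩ I n) ≤
        Measure.hausdorffMeasure 1 (circlePoint ρ b '' (A ∩ I n)) := by
      intro n
      have hinj' : Set.InjOn (circlePoint ρ b) (A ∩ I n) := hinj.mono Set.inter_subset_left
      let f' := Function.invFunOn (circlePoint ρ b) (A ∩ I n)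
      have hleft : Set.LeftInvOn f' (circlePoint ρ b) (A ∩ I n) := hinj'.leftInvOn_invFunOn
      have hlip : LipschitzOnWith (ρ * (1 - ε ^ 2)).toNNReal⁻¹ f'
          (circlePoint ρ b '' (A ∩ I n)) := by
        refine LipschitzOnWith.of_dist_le_mul ?_
        rintro _ ⟨x, hx, rfl⟩ _ ⟨y, hy, rfl⟩
        rw [hleft hx, hleft hy, NNReal.coe_inv, Real.coe_toNNReal _ hc.le, Real.dist_eq,
          ← div_eq_inv_mul, le_div_iff₀ hc, mul_comm]
        refine dist_circlePoint_ge hρ.le b ?_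
        have h1 := hx.2
        have h2 := hy.2
        simp only [I, Set.mem_Ioc, zsmul_eq_mul, Int.cast_add, Int.cast_one] at h1 h2
        rw [abs_le]
        constructor <;> nlinarith
      have := hlip.hausdorffMeasure_image_le zero_le_one
      rw [hleft.image_image, hausdorffMeasure_real, ENNReal.rpow_one,
        ENNReal.coe_inv (by simpa using hc)] at this
      calc _ ≤ ENNReal.ofReal (ρ * (1 - ε ^ 2)) * ((ENNReal.ofReal (ρ * (1 - ε ^ 2)))⁻¹ *
            Measure.hausdorffMeasure 1 (circlePoint ρ b '' (A ∩ I n))) := by gcongr; exact this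
        _ = _ := by
          rw [← mul_assoc, ENNReal.mul_inv_cancel (by simpa using hc) (by simp), one_mul]
    have hAu : A = ⋃ n, A ∩ I n := by rw [← Set.inter_iUnion, hI, Set.inter_univ]
    have hIm : ∀ n, MeasurableSet (A ∩ I n) := fun n => hA.inter measurableSet_Ioc
    calc ENNReal.ofReal (ρ * (1 - ε ^ 2)) * volume A
        = ∑' n, ENNReal.ofReal (ρ * (1 - ε ^ 2)) * volume (A ∩ I n) := by
          conv_lhs => rw [hAu]
          rw [measure_iUnion _ hIm, ENNReal.tsum_mul_left]
          exact fun m n hmn => (hId hmn).mono Set.inter_subset_right Set.inter_subset_right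
      _ ≤ ∑' n, Measure.hausdorffMeasure 1 (circlePoint ρ b '' (A ∩ I n)) :=
          ENNReal.tsum_le_tsum hpiece
      _ = Measure.hausdorffMeasure 1 (circlePoint ρ b '' A) := by
          conv_rhs => rw [hAu, Set.image_iUnion]
          rw [measure_iUnion]
          · intro m n hmn
            refine Set.disjoint_image_image ?_
            intro x hx y hy hxy
            have := hinj hx.1 hy.1 hxy
            subst this
            exact Set.disjoint_left.1 (hId hmn) hx.2 hy.2
          · exact fun n => (hIm n).image_of_continuousOn_injOn
              (continuous_circlePoint ρ b).continuousOn (hinj.mono Set.inter_subset_left)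
  have hlim : Tendsto (fun ε : ℝ => ENNReal.ofReal (ρ * (1 - ε ^ 2)) * volume A) (𝓝[>] 0)
      (𝓝 (ENNReal.ofReal ρ * volume A)) := by
    refine ENNReal.Tendsto.mul_const ?_ (Or.inl (by simpa using hρ))
    refine ENNReal.tendsto_ofReal ?_
    have : ContinuousAt (fun ε : ℝ => ρ * (1 - ε ^ 2)) 0 := by fun_prop
    have h0 := this.tendsto
    simp only [ne_eq, OfNat.ofNat_ne_zero, not_false_eq_true, zero_pow, sub_zero, mul_one] at h0
    exact h0.mono_left nhdsWithin_le_nhds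
  refine le_of_tendsto hlim ?_
  filter_upwards [Ioo_mem_nhdsGT (zero_lt_one (α := ℝ))] with ε h
  exact hε ε h.1 h.2

/-! ### The circle of points that see a pair with a given angle. -/

/-- The third coordinate vector. -/
noncomputable def pole : E3 := EuclideanSpace.single 2 1

/-- The reflection that maps the third coordinate axis to the line through `W`. -/
noncomputable def poleReflection (W : E3) : E3 ≃ₗᵢ[ℝ] E3 :=
  (ℝ ∙ (‖W‖ • pole - W))ᗮ.reflection

lemma norm_pole : ‖pole‖ = 1 := by simp [pole]

lemma poleReflection_pole (W : E3) : poleReflection W (‖W‖ • pole) = W :=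
  Submodule.reflection_sub (by simp [norm_smul, norm_pole])

/-- The explicit formula gives joint measurability in `W` and `z`. If `W` is already `‖W‖ • pole`,
the subtracted term is zero and the reflection is the identity. -/
lemma poleReflection_apply (W z : E3) : poleReflection W z =
    z - (2 * (inner ℝ (‖W‖ • pole - W) z / ‖‖W‖ • pole - W‖ ^ 2)) • (‖W‖ • pole - W) := by
  rw [poleReflection, Submodule.reflection_orthogonal_apply, Submodule.reflection_singleton_apply]
  simp only [RCLike.ofReal_real_eq_id, id, two_smul, two_mul, add_smul]
  abel

lemma measurable_poleReflection {U : Type*} [MeasurableSpace U] {W z : U → E3}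
    (hW : Measurable W) (hz : Measurable z) :
    Measurable fun u => poleReflection (W u) (z u) := by
  simp_rw [poleReflection_apply]
  fun_prop

/-- The points at distance `R` from `0` and from `d • pole` form a circle. -/
lemma image_circlePoint {d R ρ : ℝ} (hρ : 0 < ρ) (hd : 0 < d) (hR : 0 ≤ R)
    (hRρ : R ^ 2 = ρ ^ 2 + (d / 2) ^ 2) :
    circlePoint ρ (d / 2) '' Set.Ioc (-Real.pi) Real.pi =
      {z | ‖z‖ = R ∧ dist z (d • pole) = R} := by
  have hn : ∀ z : E3, ‖z‖ = R ↔ z 0 ^ 2 + z 1 ^ 2 + z 2 ^ 2 = R ^ 2 := fun z => by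
    rw [EuclideanSpace.norm_eq, Real.sqrt_eq_iff_eq_sq (by positivity) hR]
    simp [Fin.sum_univ_three]
  have hdist : ∀ z : E3, dist z (d • pole) = R ↔ z 0 ^ 2 + z 1 ^ 2 + (z 2 - d) ^ 2 = R ^ 2 :=
    fun z => by
      rw [dist_eq_norm, hn]
      simp [pole]
  ext z
  simp only [Set.mem_image, Set.mem_ofPred_eq, hn, hdist]
  constructor
  · rintro ⟨t, -, rfl⟩
    simp only [circlePoint, PiLp.toLp_apply, Matrix.cons_val]
    constructor
    · rw [hRρ]; linear_combination ρ ^ 2 * Real.sin_sq_add_cos_sq t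
    · rw [hRρ]; linear_combination ρ ^ 2 * Real.sin_sq_add_cos_sq t
  · rintro ⟨h1, h2⟩
    -- The difference of the two sphere equations is the equation of the bisecting plane.
    have hz2 : z 2 = d / 2 := by
      have : d * (z 2 - d / 2) = 0 := by linear_combination (h1 - h2) / 2
      have := (mul_eq_zero.1 this).resolve_left hd.ne'
      linarith
    let w : ℂ := ⟨z 0, z 1⟩
    have hw : ‖w‖ = ρ := by
      rw [Complex.norm_def, Real.sqrt_eq_iff_eq_sq (Complex.normSq_nonneg _) hρ.le,
        Complex.normSq_apply]
      change z 0 * z 0 + z 1 * z 1 = ρ ^ 2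
      rw [hz2] at h1
      linear_combination h1 + hRρ
    refine ⟨w.arg, ⟨Complex.neg_pi_lt_arg w, Complex.arg_le_pi w⟩, ?_⟩
    have hc := Complex.norm_mul_cos_arg w
    have hs := Complex.norm_mul_sin_arg w
    rw [hw] at hc hs
    ext i
    fin_cases i
    · exact hc
    · exact hs
    · exact hz2.symm

/-- The point with angle `t` on the circle of points that see `0` and `W` with a given angle
`θ`; here `s = sin (θ / 2)` and `c = |cos (θ / 2)|`. -/
noncomputable def locusPoint (s c : ℝ) (W : E3) (t : ℝ) : E3 :=
  poleReflection W (circlePoint (‖W‖ * c / (2 * s)) (‖W‖ / 2) t)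

lemma image_locusPoint {s c : ℝ} (hs : 0 < s) (hc : 0 < c) (hsc : s ^ 2 + c ^ 2 = 1) {W : E3}
    (hW : W ≠ 0) :
    locusPoint s c W '' Set.Ioc (-Real.pi) Real.pi =
      {z | ‖z‖ = ‖W‖ / (2 * s) ∧ dist z W = ‖W‖ / (2 * s)} := by
  have hW' : 0 < ‖W‖ := norm_pos_iff.2 hW
  have : locusPoint s c W '' Set.Ioc (-Real.pi) Real.pi = poleReflection W ''
      (circlePoint (‖W‖ * c / (2 * s)) (‖W‖ / 2) '' Set.Ioc (-Real.pi) Real.pi) := by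
    rw [Set.image_image]; rfl
  rw [this, image_circlePoint (R := ‖W‖ / (2 * s)) (by positivity) hW' (by positivity)]
  · ext z
    have hdist : dist ((poleReflection W).symm z) (‖W‖ • pole) = dist z W := by
      rw [← (poleReflection W).dist_map, LinearIsometryEquiv.apply_symm_apply, poleReflection_pole]
    rw [LinearIsometryEquiv.image_eq_preimage_symm, Set.mem_preimage, Set.mem_ofPred_eq,
      Set.mem_ofPred_eq, LinearIsometryEquiv.norm_map, hdist]
  · field_simp
    linear_combination -hsc

lemma measurable_locusPoint {U : Type*} [MeasurableSpace U] (s c : ℝ) {W : U → E3} {t : U → ℝ}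
    (hW : Measurable W) (ht : Measurable t) :
    Measurable fun u => locusPoint s c (W u) (t u) := by
  refine measurable_poleReflection hW ?_
  unfold circlePoint
  refine (PiLp.continuous_toLp 2 _).measurable.comp (measurable_pi_lambda _ fun i => ?_)
  fin_cases i <;> simp <;> fun_prop

lemma hausdorffMeasure_image_locusPoint {s c : ℝ} (hs : 0 < s) (hc : 0 < c) {W : E3} (hW : W ≠ 0)
    {A : Set ℝ} (hA : MeasurableSet A) (hAs : A ⊆ Set.Ioc (-Real.pi) Real.pi) :
    Measure.hausdorffMeasure 1 (locusPoint s c W '' A) =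
      ENNReal.ofReal (‖W‖ * c / (2 * s)) * volume A := by
  have hW' : 0 < ‖W‖ := norm_pos_iff.2 hW
  rw [← hausdorffMeasure_image_circlePoint (by positivity) (‖W‖ / 2) hA hAs,
    ← (poleReflection W).isometry.hausdorffMeasure_image (Or.inl zero_le_one)
      (circlePoint _ _ '' A), Set.image_image]
  rfl

/-- Seeing two points from equal distances with angle `θ` or `2π - θ`. -/
lemma angle_eq_or_iff {θ : ℝ} (hθ0 : 0 < θ) (hθ2 : θ < 2 * Real.pi) {W Z : E3} (hW : W ≠ 0)
    (hZ : ‖Z‖ = dist Z W) :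
    (EuclideanGeometry.angle 0 Z W = θ ∨ EuclideanGeometry.angle 0 Z W = 2 * Real.pi - θ) ↔
      ‖Z‖ = ‖W‖ / (2 * Real.sin (θ / 2)) := by
  have hs : 0 < Real.sin (θ / 2) := Real.sin_pos_of_pos_of_lt_pi (by linarith) (by linarith)
  have hZ0 : 0 < ‖Z‖ := by
    rw [norm_pos_iff]
    rintro rfl
    rw [norm_zero, dist_comm, dist_zero_right] at hZ
    exact hW (norm_eq_zero.1 hZ.symm)
  have hcos : (EuclideanGeometry.angle 0 Z W = θ ∨
      EuclideanGeometry.angle 0 Z W = 2 * Real.pi - θ) ↔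
      Real.cos (EuclideanGeometry.angle 0 Z W) = Real.cos θ := by
    constructor
    · rintro (h | h)
      · rw [h]
      · rw [h, Real.cos_two_pi_sub]
    · intro h
      have hm : EuclideanGeometry.angle 0 Z W ∈ Set.Icc 0 Real.pi :=
        ⟨EuclideanGeometry.angle_nonneg _ _ _, EuclideanGeometry.angle_le_pi _ _ _⟩
      rcases le_total θ Real.pi with hle | hle
      · exact Or.inl (Real.injOn_cos hm ⟨hθ0.le, hle⟩ h)
      · rw [← Real.cos_two_pi_sub θ] at h
        exact Or.inr (Real.injOn_cos hm ⟨by linarith, by linarith⟩ h)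
  -- Law of cosines in the isosceles triangle. Comparing with `cos θ = 1 - 2 * sin (θ / 2) ^ 2`
  -- determines `‖Z‖`.
  have hcosW : Real.cos (EuclideanGeometry.angle 0 Z W) = 1 - ‖W‖ ^ 2 / (2 * ‖Z‖ ^ 2) := by
    have h1 := EuclideanGeometry.law_cos 0 Z W
    rw [dist_zero_left, dist_comm W Z, ← hZ, dist_zero_left] at h1
    field_simp
    linear_combination h1
  have hcosθ : Real.cos θ = 1 - 2 * Real.sin (θ / 2) ^ 2 := by
    have h2 := Real.sin_sq_add_cos_sq (θ / 2)
    rw [show θ = 2 * (θ / 2) by ring, Real.cos_two_mul, show 2 * (θ / 2) / 2 = θ / 2 by ring]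
    linarith
  rw [hcos, hcosW, hcosθ, eq_div_iff (by positivity)]
  have h3 : (1 - ‖W‖ ^ 2 / (2 * ‖Z‖ ^ 2) = 1 - 2 * Real.sin (θ / 2) ^ 2) ↔
      (‖Z‖ * (2 * Real.sin (θ / 2))) ^ 2 = ‖W‖ ^ 2 := by
    constructor
    · intro h
      field_simp at h
      linear_combination h
    · intro h
      field_simp
      linear_combination h
  rw [h3, sq_eq_sq₀ (by positivity) (norm_nonneg _)]

lemma abs_cos_half_pos {θ : ℝ} (hθ0 : 0 < θ) (hθ2 : θ < 2 * Real.pi) (hθ : θ ≠ Real.pi) :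
    0 < |Real.cos (θ / 2)| := by
  rw [abs_pos]
  intro h0
  apply hθ
  have := Real.injOn_cos (x₁ := θ / 2) ⟨by linarith, by linarith⟩
    (x₂ := Real.pi / 2) ⟨by positivity, by linarith [Real.pi_pos]⟩
    (by rw [h0, Real.cos_pi_div_two])
  linarith

lemma sin_half_pos {θ : ℝ} (hθ0 : 0 < θ) (hθ2 : θ < 2 * Real.pi) : 0 < Real.sin (θ / 2) :=
  Real.sin_pos_of_pos_of_lt_pi (by linarith) (by linarith)

/-- The angle locus of two points of a configuration, seen from the first of them. -/
lemma angleLocus_eq_image {θ : ℝ} (hθ0 : 0 < θ) (hθ2 : θ < 2 * Real.pi) (hθ : θ ≠ Real.pi)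
    {φ : Set E3} {x y : E3} (hx : x ∈ φ) (hy : y ∈ φ) (hxy : y ≠ x) :
    angleLocus ((fun v => v - x) '' φ) θ 0 (y - x) =
      locusPoint (Real.sin (θ / 2)) |Real.cos (θ / 2)| (y - x) ''
        {t ∈ Set.Ioc (-Real.pi) Real.pi | ∀ v ∈ φ, v ∉ Metric.ball
          (x + locusPoint (Real.sin (θ / 2)) |Real.cos (θ / 2)| (y - x) t)
          (‖y - x‖ / (2 * Real.sin (θ / 2)))} := by
  set s := Real.sin (θ / 2) with hs
  set c := |Real.cos (θ / 2)| with hc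
  have hs0 : 0 < s := sin_half_pos hθ0 hθ2
  have hc0 : 0 < c := abs_cos_half_pos hθ0 hθ2 hθ
  have hsc : s ^ 2 + c ^ 2 = 1 := by rw [hc, sq_abs]; exact Real.sin_sq_add_cos_sq _
  have hW : y - x ≠ 0 := sub_ne_zero.2 hxy
  have himg := image_locusPoint hs0 hc0 hsc hW
  have hball : ∀ Z v : E3, v ∉ Metric.ball (x + Z) (‖y - x‖ / (2 * s)) ↔
      ‖y - x‖ / (2 * s) ≤ dist Z (v - x) := by
    intro Z v
    rw [Metric.mem_ball, not_lt, dist_comm v, dist_eq_norm, dist_eq_norm]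
    rw [show x + Z - v = Z - (v - x) by abel]
  ext Z
  constructor
  · rintro ⟨⟨h1, h2⟩, h3⟩
    -- Both `0` and `y - x` belong to the translated configuration, so each cell condition bounds
    -- one distance by the other.
    have h0y : ‖Z‖ = dist Z (y - x) := by
      rw [← dist_zero_right]
      exact le_antisymm (h1 _ ⟨y, hy, rfl⟩) (h2 0 ⟨x, hx, sub_self x⟩)
    rw [angle_eq_or_iff hθ0 hθ2 hW h0y] at h3
    have hmem : Z ∈ locusPoint s c (y - x) '' Set.Ioc (-Real.pi) Real.pi := by
      rw [himg]
      exact ⟨h3, by rw [← h0y, h3]⟩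
    obtain ⟨t, ht, rfl⟩ := hmem
    refine ⟨t, ⟨ht, fun v hv => ?_⟩, rfl⟩
    rw [hball, ← h3, ← dist_zero_right]
    exact h1 _ ⟨v, hv, rfl⟩
  · rintro ⟨t, ⟨ht, hv⟩, rfl⟩
    have hmem : locusPoint s c (y - x) t ∈ {z | ‖z‖ = ‖y - x‖ / (2 * s) ∧
        dist z (y - x) = ‖y - x‖ / (2 * s)} := by
      rw [← himg]
      exact ⟨t, ht, rfl⟩
    obtain ⟨h1, h2⟩ := hmem
    refine ⟨⟨?_, ?_⟩, (angle_eq_or_iff hθ0 hθ2 hW (h1.trans h2.symm)).2 h1⟩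
    · rintro _ ⟨v, hvφ, rfl⟩
      rw [dist_zero_right, h1]
      exact (hball _ _).1 (hv v hvφ)
    · rintro _ ⟨v, hvφ, rfl⟩
      rw [h2]
      exact (hball _ _).1 (hv v hvφ)

lemma continuous_locusPoint (s c : ℝ) (W : E3) : Continuous (locusPoint s c W) :=
  (poleReflection W).continuous.comp (continuous_circlePoint _ _)

lemma norm_locusPoint {s c : ℝ} (hs : 0 < s) (hc : 0 < c) (hsc : s ^ 2 + c ^ 2 = 1) {W : E3}
    (hW : W ≠ 0) {t : ℝ} (ht : t ∈ Set.Ioc (-Real.pi) Real.pi) :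
    ‖locusPoint s c W t‖ = ‖W‖ / (2 * s) ∧ dist (locusPoint s c W t) W = ‖W‖ / (2 * s) := by
  have : locusPoint s c W t ∈ {z | ‖z‖ = ‖W‖ / (2 * s) ∧ dist z W = ‖W‖ / (2 * s)} := by
    rw [← image_locusPoint hs hc hsc hW]
    exact ⟨t, ht, rfl⟩
  exact this

/-- Writing the length as an integral over the angle of a void indicator makes it accessible to
Tonelli and to the Mecke formula. -/
lemma hausdorffMeasure_angleLocus {Ω : Type*} (Φ : Ω → Set E3) (ω : Ω) {θ : ℝ} (hθ0 : 0 < θ)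
    (hθ2 : θ < 2 * Real.pi) (hθ : θ ≠ Real.pi) {x y : E3} (hx : x ∈ Φ ω) (hy : y ∈ Φ ω)
    (hxy : y ≠ x) :
    Measure.hausdorffMeasure 1 (angleLocus ((fun v => v - x) '' Φ ω) θ 0 (y - x)) =
      ∫⁻ t in Set.Ioc (-Real.pi) Real.pi,
        ENNReal.ofReal (‖y - x‖ * |Real.cos (θ / 2)| / (2 * Real.sin (θ / 2))) *
        (voidEvent Φ (Metric.ball
          (x + locusPoint (Real.sin (θ / 2)) |Real.cos (θ / 2)| (y - x) t)
          (‖y - x‖ / (2 * Real.sin (θ / 2))))).indicator 1 ω := by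
  set s := Real.sin (θ / 2)
  set c := |Real.cos (θ / 2)|
  set A := {t : ℝ | ∀ v ∈ Φ ω, v ∉ Metric.ball (x + locusPoint s c (y - x) t)
    (‖y - x‖ / (2 * s))} with hA
  -- Avoiding an open ball whose centre moves continuously is a closed condition, even after
  -- intersecting over all points of the configuration.
  have hAc : IsClosed A := by
    have : A = ⋂ v ∈ Φ ω, {t | ‖y - x‖ / (2 * s) ≤ dist v (x + locusPoint s c (y - x) t)} := by
      ext t
      simp [hA]
    rw [this]
    have := continuous_locusPoint s c (y - x)
    exact isClosed_biInter fun v _ => isClosed_le (by fun_prop) (by fun_prop)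
  have hloc : angleLocus ((fun v => v - x) '' Φ ω) θ 0 (y - x) =
      locusPoint s c (y - x) '' (A ∩ Set.Ioc (-Real.pi) Real.pi) := by
    rw [angleLocus_eq_image hθ0 hθ2 hθ hx hy hxy, Set.inter_comm]
    rfl
  rw [hloc, hausdorffMeasure_image_locusPoint (sin_half_pos hθ0 hθ2) (abs_cos_half_pos hθ0 hθ2 hθ)
    (sub_ne_zero.2 hxy) (hAc.measurableSet.inter measurableSet_Ioc) Set.inter_subset_right]
  have hind : ∀ t, (voidEvent Φ (Metric.ball (x + locusPoint s c (y - x) t)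
      (‖y - x‖ / (2 * s)))).indicator (1 : Ω → ℝ≥0∞) ω = A.indicator 1 t := fun t => rfl
  simp_rw [hind]
  rw [lintegral_const_mul _ (measurable_one.indicator hAc.measurableSet),
    lintegral_indicator_one hAc.measurableSet, Measure.restrict_apply hAc.measurableSet]

/-! ### The Palm sum as an integral over pairs. -/

lemma orderedLocusLength_translate (lt : E3 → E3 → Prop) (θ : ℝ) (φ : Set E3) (x : E3) :
    orderedLocusLength lt θ ((fun v => v - x) '' φ) =
      ∑' y : φ, {v | lt v 0}.indicator (fun v => Measure.hausdorffMeasure 1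
        (angleLocus ((fun v => v - x) '' φ) θ 0 v)) (y - x) := by
  let F : E3 → ℝ≥0∞ := fun v => Measure.hausdorffMeasure 1
    (angleLocus ((fun v => v - x) '' φ) θ 0 v)
  change ∑' X : ((fun v => v - x) '' φ ∩ {v | lt v 0} : Set E3), F X =
    ∑' y : φ, {v | lt v 0}.indicator F (y - x)
  rw [tsum_subtype _ F, tsum_subtype φ fun y => {v | lt v 0}.indicator F (y - x),
    ← (Equiv.subRight x).tsum_eq]
  refine tsum_congr fun y => ?_
  have : y - x ∈ (fun v => v - x) '' φ ↔ y ∈ φ := by simp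
  simp only [Equiv.subRight_apply]
  by_cases hy : y ∈ φ <;> by_cases hl : y - x ∈ {v | lt v 0}
  · rw [Set.indicator_of_mem (show y - x ∈ (fun v => v - x) '' φ ∩ {v | lt v 0} from
      ⟨this.2 hy, hl⟩), Set.indicator_of_mem hy, Set.indicator_of_mem hl]
  · rw [Set.indicator_of_notMem fun h => hl h.2, Set.indicator_of_mem hy,
      Set.indicator_of_notMem hl]
  · rw [Set.indicator_of_notMem fun h => hy (this.1 h.1), Set.indicator_of_notMem hy]
  · rw [Set.indicator_of_notMem fun h => hl h.2, Set.indicator_of_notMem hy]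

/-- The weight of an ordered pair of nuclei: the radius of the circle that carries its angle locus,
if the first nucleus lies in the window `B`. -/
noncomputable def pairWeight (lt : E3 → E3 → Prop) (θ : ℝ) (B : Set E3) (u : E3 × E3) : ℝ≥0∞ :=
  B.indicator 1 u.1 * {v | lt v 0}.indicator
    (fun v => ENNReal.ofReal (‖v‖ * |Real.cos (θ / 2)| / (2 * Real.sin (θ / 2)))) (u.2 - u.1)

lemma measurable_pairWeight {lt : E3 → E3 → Prop} (hlt : IsNucleusOrder lt) (θ : ℝ) {B : Set E3}
    (hB : MeasurableSet B) : Measurable (pairWeight lt θ B) := by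
  refine ((measurable_one.indicator hB).comp measurable_fst).mul ?_
  refine Measurable.comp (g := {v | lt v 0}.indicator _) ?_ (measurable_snd.sub measurable_fst)
  exact Measurable.indicator (by fun_prop) hlt.measurable_neg

/-- The integrand whose integral over the angle `t` is the length of the locus of the pair `u`. -/
noncomputable def locusIntegrand {Ω : Type*} (Φ : Ω → Set E3) (lt : E3 → E3 → Prop) (θ : ℝ)
    (B : Set E3) (t : ℝ) (p : Ω × (E3 × E3)) : ℝ≥0∞ :=
  pairWeight lt θ B p.2 * (voidEvent Φ (Metric.ball
    (p.2.1 + locusPoint (Real.sin (θ / 2)) |Real.cos (θ / 2)| (p.2.2 - p.2.1) t)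
    (‖p.2.2 - p.2.1‖ / (2 * Real.sin (θ / 2))))).indicator 1 p.1

lemma indicator_orderedLocusLength_eq {Ω : Type*} (Φ : Ω → Set E3) (ω : Ω) {lt : E3 → E3 → Prop}
    (hlt : IsNucleusOrder lt) (B : Set E3) {θ : ℝ} (hθ0 : 0 < θ) (hθ2 : θ < 2 * Real.pi)
    (hθ : θ ≠ Real.pi) {x : E3} (hx : x ∈ Φ ω) :
    B.indicator (fun x => orderedLocusLength lt θ ((fun y => y - x) '' Φ ω)) x =
      ∑' y : Φ ω, ∫⁻ t in Set.Ioc (-Real.pi) Real.pi, locusIntegrand Φ lt θ B t (ω, (x, y)) := by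
  by_cases hxB : x ∈ B
  · rw [Set.indicator_of_mem hxB, orderedLocusLength_translate]
    refine tsum_congr fun y => ?_
    by_cases hl : (y : E3) - x ∈ {v | lt v 0}
    · have hxy : (y : E3) ≠ x := by
        intro he
        rw [he, sub_self] at hl
        exact hlt.irrefl 0 hl
      rw [Set.indicator_of_mem hl, hausdorffMeasure_angleLocus Φ ω hθ0 hθ2 hθ hx y.2 hxy]
      simp only [locusIntegrand, pairWeight, Set.indicator_of_mem hxB, Set.indicator_of_mem hl,
        Pi.one_apply, one_mul]
    · rw [Set.indicator_of_notMem hl]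
      simp only [locusIntegrand, pairWeight, Set.indicator_of_notMem hl, mul_zero, zero_mul,
        lintegral_zero]
  · rw [Set.indicator_of_notMem hxB]
    simp only [locusIntegrand, pairWeight, Set.indicator_of_notMem hxB, zero_mul, lintegral_zero,
      tsum_zero]

section

variable {Ω : Type*} [MeasurableSpace Ω] {P : Measure Ω} {Φ : Ω → Set E3} {lam : ℝ}

lemma IsHomogeneousPoisson.measurable_locusIntegrand (h : IsHomogeneousPoisson P Φ lam)
    {lt : E3 → E3 → Prop} (hlt : IsNucleusOrder lt) {B : Set E3} (hB : MeasurableSet B) (θ : ℝ) :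
    Measurable fun q : (Ω × (E3 × E3)) × ℝ => locusIntegrand Φ lt θ B q.2 q.1 := by
  refine ((measurable_pairWeight hlt θ hB).comp (measurable_snd.comp measurable_fst)).mul ?_
  have hz := measurable_locusPoint (U := (E3 × E3) × ℝ) (Real.sin (θ / 2)) |Real.cos (θ / 2)|
    (W := fun q => q.1.2 - q.1.1) (t := fun q => q.2) (by fun_prop) (by fun_prop)
  have hv := h.measurable_indicator_voidEvent_ball (T := (E3 × E3) × ℝ)
    (z := fun q => q.1.1 + locusPoint (Real.sin (θ / 2)) |Real.cos (θ / 2)| (q.1.2 - q.1.1) q.2)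
    (R := fun q => ‖q.1.2 - q.1.1‖ / (2 * Real.sin (θ / 2))) (by fun_prop) (by fun_prop)
  exact hv.comp (g := fun p : Ω × ((E3 × E3) × ℝ) => _)
    (f := fun q : (Ω × (E3 × E3)) × ℝ => (q.1.1, (q.1.2, q.2))) (by fun_prop)

/-- The double sum over nuclei is an integral against `pairMeasure`. Moving `t` outermost by Tonelli
leaves, for each `t`, a single moving void ball per pair. -/
lemma IsHomogeneousPoisson.lintegral_tsum_orderedLocusLength [IsProbabilityMeasure P]
    (h : IsHomogeneousPoisson P Φ lam) {lt : E3 → E3 → Prop} (hlt : IsNucleusOrder lt)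
    {B : Set E3} (hB : MeasurableSet B) {θ : ℝ} (hθ0 : 0 < θ) (hθ2 : θ < 2 * Real.pi)
    (hθ : θ ≠ Real.pi) :
    ∫⁻ ω, ∑' x : ↥(Φ ω ∩ B), orderedLocusLength lt θ ((fun y => y - (x : E3)) '' Φ ω) ∂P =
      ∫⁻ t in Set.Ioc (-Real.pi) Real.pi, ∫⁻ p, locusIntegrand Φ lt θ B t p ∂h.pairMeasure := by
  have hH := h.measurable_locusIntegrand hlt hB θ
  have hI : Measurable fun p : Ω × (E3 × E3) =>
      ∫⁻ t in Set.Ioc (-Real.pi) Real.pi, locusIntegrand Φ lt θ B t p := hH.lintegral_prod_right'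
  have hsf : SFinite h.pairMeasure := by
    unfold pairMeasure; infer_instance
  refine Eq.trans ?_ (lintegral_lintegral_swap (f := fun p t => locusIntegrand Φ lt θ B t p)
    hH.aemeasurable)
  rw [h.lintegral_pairMeasure hI]
  refine lintegral_congr fun ω => ?_
  have := h.sFinite_pointMeasure ω
  have hIω : Measurable fun u : E3 × E3 =>
      ∫⁻ t in Set.Ioc (-Real.pi) Real.pi, locusIntegrand Φ lt θ B t (ω, u) :=
    hI.comp (measurable_prodMk_left (x := ω))
  rw [lintegral_prod _ hIω.aemeasurable, lintegral_pointMeasure,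
    tsum_subtype (Φ ω ∩ B) fun x => orderedLocusLength lt θ ((fun y => y - x) '' Φ ω),
    ← Set.indicator_indicator, ← tsum_subtype]
  refine tsum_congr fun x => ?_
  rw [lintegral_pointMeasure, indicator_orderedLocusLength_eq Φ ω hlt B hθ0 hθ2 hθ x.2]

/-- The radius of the circle of the pair `(0, v)`, times the probability that the ball around a
point of the circle, with `0` and `v` on its boundary, is void. -/
noncomputable def discountedRadius (lam θ : ℝ) (v : E3) : ℝ≥0∞ :=
  ENNReal.ofReal (‖v‖ * |Real.cos (θ / 2)| / (2 * Real.sin (θ / 2)) *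
    Real.exp (-(lam * (4 / 3 * Real.pi * (‖v‖ / (2 * Real.sin (θ / 2))) ^ 3))))

/-- Both nuclei lie on the sphere around the locus point, so the open ball contains neither and the
Mecke formula applies. The ball volume depends only on the distance of the nuclei, hence `t`
disappears from the result. -/
lemma IsHomogeneousPoisson.lintegral_pairWeight_void [IsProbabilityMeasure P]
    (h : IsHomogeneousPoisson P Φ lam) (hlam : 0 < lam) {lt : E3 → E3 → Prop}
    (hlt : IsNucleusOrder lt)
    {B : Set E3} (hB : MeasurableSet B) {θ : ℝ} (hθ0 : 0 < θ) (hθ2 : θ < 2 * Real.pi)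
    (hθ : θ ≠ Real.pi) {t : ℝ} (ht : t ∈ Set.Ioc (-Real.pi) Real.pi) :
    ∫⁻ p, locusIntegrand Φ lt θ B t p ∂h.pairMeasure =
      ENNReal.ofReal lam ^ 2 * (volume B * ∫⁻ v in {v | lt v 0}, discountedRadius lam θ v) := by
  set s := Real.sin (θ / 2) with hs
  set c := |Real.cos (θ / 2)| with hc
  have hs0 : 0 < s := sin_half_pos hθ0 hθ2
  have hc0 : 0 < c := abs_cos_half_pos hθ0 hθ2 hθ
  have hsc : s ^ 2 + c ^ 2 = 1 := by rw [hc, sq_abs]; exact Real.sin_sq_add_cos_sq _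
  have hz := measurable_locusPoint (U := E3 × E3) s c (W := fun q => q.2 - q.1)
      (t := fun _ => t) (by fun_prop) (by fun_prop)
  have hdiag : ∀ u, pairWeight lt θ B u ≠ 0 → u.2 - u.1 ≠ 0 := by
    intro u hu h0
    apply hu
    rw [pairWeight, h0, Set.indicator_of_notMem (show (0 : E3) ∉ {v | lt v 0} from hlt.irrefl 0),
      mul_zero]
  unfold locusIntegrand
  rw [h.lintegral_pairMeasure_void_ball hlam
    (z := fun u => u.1 + locusPoint s c (u.2 - u.1) t) (R := fun u => ‖u.2 - u.1‖ / (2 * s))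
    (by fun_prop) (by fun_prop) (measurable_pairWeight hlt θ hB)]
  · congr 1
    let k : E3 → ℝ≥0∞ := {v | lt v 0}.indicator (discountedRadius lam θ)
    have hk : Measurable k := by
      refine Measurable.indicator ?_ hlt.measurable_neg
      unfold discountedRadius
      fun_prop
    have hfun : ∀ u : E3 × E3, pairWeight lt θ B u * ENNReal.ofReal (Real.exp (-(lam * (volume
        (Metric.ball (u.1 + locusPoint s c (u.2 - u.1) t) (‖u.2 - u.1‖ / (2 * s)))).toReal))) =
        B.indicator 1 u.1 * k (u.2 - u.1) := by
      intro u
      rw [pairWeight, mul_assoc]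
      congr 1
      by_cases hl : u.2 - u.1 ∈ {v | lt v 0}
      · simp only [k, Set.indicator_of_mem hl, discountedRadius]
        rw [← ENNReal.ofReal_mul (by positivity), EuclideanSpace.volume_ball_fin_three,
          ENNReal.toReal_mul, ENNReal.toReal_pow, ENNReal.toReal_ofReal (by positivity),
          ENNReal.toReal_ofReal (by positivity)]
        congr 4
        ring
      · simp only [k, Set.indicator_of_notMem hl, zero_mul]
    simp_rw [hfun]
    rw [lintegral_prod _ (by
      refine (((measurable_one.indicator hB).comp measurable_fst).mul
        (hk.comp (measurable_snd.sub measurable_fst))).aemeasurable)]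
    -- Translation invariance of Lebesgue measure separates the first nucleus from the displacement.
    have hin : ∀ x : E3, ∫⁻ y, B.indicator 1 x * k (y - x) = B.indicator 1 x * ∫⁻ v, k v := by
      intro x
      rw [lintegral_const_mul _ (by fun_prop), lintegral_sub_right_eq_self]
    simp_rw [hin]
    rw [lintegral_mul_const _ (measurable_one.indicator hB), lintegral_indicator_one hB,
      lintegral_indicator hlt.measurable_neg]
  · intro x
    by_contra hne
    exact hdiag _ hne (sub_self x)
  · intro u hu
    have := norm_locusPoint hs0 hc0 hsc (hdiag u hu) ht
    constructor
    · rw [dist_self_add_right, this.1]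
    · have hd : dist (u.1 + locusPoint s c (u.2 - u.1) t) u.2 =
          dist (locusPoint s c (u.2 - u.1) t) (u.2 - u.1) := by
        rw [dist_eq_norm, dist_eq_norm]
        congr 1
        abel
      rw [dist_comm, hd, this.2]

end

/-! ### Symmetry of the order and the radial integral. -/

/-- Translation invariance of the order makes `v ↦ -v` exchange the negative and the positive
vectors. These are disjoint and cover almost everything, so an even function has half of its
integral on each. -/
lemma two_mul_setLIntegral_order {lt : E3 → E3 → Prop} (hlt : IsNucleusOrder lt)
    {f : E3 → ℝ≥0∞} (hf : ∀ v, f (-v) = f v) :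
    2 * ∫⁻ v in {v | lt v 0}, f v = ∫⁻ v, f v := by
  have hneg : ∀ v, lt (-v) 0 ↔ lt 0 v := by
    intro v
    constructor
    · intro h
      simpa using hlt.translate _ _ v h
    · intro h
      simpa using hlt.translate _ _ (-v) h
  have hm : MeasurableSet {v : E3 | lt 0 v} := by
    have : {v : E3 | lt 0 v} = Neg.neg ⁻¹' {v | lt v 0} := by
      ext v
      exact (hneg v).symm
    rw [this]
    exact measurable_neg hlt.measurable_neg
  have h2 : ∫⁻ v in {v | lt 0 v}, f v = ∫⁻ v in {v | lt v 0}, f v := by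
    rw [← lintegral_indicator hm, ← lintegral_indicator hlt.measurable_neg,
      ← lintegral_neg_eq_self]
    refine lintegral_congr fun v => ?_
    have := hneg (-v)
    rw [neg_neg] at this
    simp only [Set.indicator, Set.mem_ofPred_eq, hf]
    by_cases hv : lt v 0
    · rw [if_pos hv, if_pos (this.1 hv)]
    · rw [if_neg hv, if_neg (mt this.2 hv)]
  have hdisj : Disjoint {v : E3 | lt v 0} {v | lt 0 v} :=
    Set.disjoint_left.2 fun v h h' => hlt.irrefl v (hlt.trans _ _ _ h h')
  rw [two_mul]
  nth_rw 2 [← h2]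
  rw [← lintegral_union hm hdisj]
  conv_rhs => rw [← setLIntegral_univ]
  refine setLIntegral_congr ?_
  exact Filter.eventuallyEq_univ.2 hlt.ae_comparable

lemma lintegral_discountedRadius {lam : ℝ} (hlam : 0 < lam) {θ : ℝ} (hθ0 : 0 < θ)
    (hθ2 : θ < 2 * Real.pi) :
    ∫⁻ v, discountedRadius lam θ v = ENNReal.ofReal (4 / lam *
      (6 / (Real.pi * lam)) ^ ((1 : ℝ) / 3) * Real.Gamma (4 / 3) *
        |Real.cos (θ / 2)| * Real.sin (θ / 2) ^ 3) := by
  set s := Real.sin (θ / 2) with hs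
  set c := |Real.cos (θ / 2)| with hc
  have hs0 : 0 < s := sin_half_pos hθ0 hθ2
  have hc0 : 0 ≤ c := abs_nonneg _
  -- Chosen so that `lam` times the volume of a ball of radius `r / (2 * s)` is `a * r ^ 3`. The
  -- circle radius contributes `r` and polar coordinates `r ^ 2`, which leads to the Gamma integral
  -- of `r ^ 3 * exp (-a * r ^ 3)`.
  set a := lam * Real.pi / (6 * s ^ 3) with ha
  have ha0 : 0 < a := by positivity
  let f : ℝ → ℝ := fun r => r * c / (2 * s) * Real.exp (-(lam * (4 / 3 * Real.pi *
    (r / (2 * s)) ^ 3)))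
  have hf : ∀ r ∈ Set.Ioi (0 : ℝ), r ^ 2 * f r =
      c / (2 * s) * (r ^ (3 : ℝ) * Real.exp (-a * r ^ (3 : ℝ))) := by
    intro r hr
    have hr' : r ^ (3 : ℝ) = r ^ 3 := by exact_mod_cast Real.rpow_natCast r 3
    have hexp : -(lam * (4 / 3 * Real.pi * (r / (2 * s)) ^ 3)) = -a * r ^ 3 := by
      rw [ha]; field_simp; ring
    simp only [f]
    rw [hr', hexp]
    ring
  have hint : Integrable fun v : E3 => f ‖v‖ := by
    rw [integrable_fun_norm_addHaar (volume : Measure E3) (f := f)]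
    have h3 : Module.finrank ℝ E3 - 1 = 2 := by simp
    rw [h3]
    refine IntegrableOn.congr_fun (f := fun r =>
      c / (2 * s) * (r ^ (3 : ℝ) * Real.exp (-a * r ^ (3 : ℝ)))) ?_
      (fun r hr => by rw [smul_eq_mul, hf r hr]) measurableSet_Ioi
    exact (integrableOn_rpow_mul_exp_neg_mul_rpow (by norm_num) (by norm_num) ha0).const_mul _
  change ∫⁻ v : E3, ENNReal.ofReal (f ‖v‖) = _
  rw [← ofReal_integral_eq_lintegral_ofReal hint]
  · congr 1
    rw [integral_fun_norm_addHaar (volume : Measure E3) f]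
    have h3 : Module.finrank ℝ E3 = 3 := by simp
    rw [h3, setIntegral_congr_fun (g := fun r =>
      c / (2 * s) * (r ^ (3 : ℝ) * Real.exp (-a * r ^ (3 : ℝ)))) measurableSet_Ioi
      (fun r hr => by rw [smul_eq_mul]; exact hf r hr), integral_const_mul,
      integral_rpow_mul_exp_neg_mul_rpow (by norm_num) (by norm_num) ha0, measureReal_def,
      EuclideanSpace.volume_ball_fin_three]
    have hK : a⁻¹ = 6 / (Real.pi * lam) * s ^ 3 := by
      rw [ha]; field_simp
    -- Splitting the exponent as `1 + 1 / 3` lets the cube root of `s ^ 3` be taken exactly.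
    have hpow : a ^ (-((3 : ℝ) + 1) / 3) =
        6 / (Real.pi * lam) * s ^ 3 * ((6 / (Real.pi * lam)) ^ ((1 : ℝ) / 3) * s) := by
      rw [show -((3 : ℝ) + 1) / 3 = -(1 + 1 / 3) by norm_num, Real.rpow_neg ha0.le,
        ← Real.inv_rpow ha0.le, hK, Real.rpow_add (by positivity), Real.rpow_one,
        Real.mul_rpow (by positivity) (by positivity), ← Real.rpow_natCast, ← Real.rpow_mul hs0.le]
      norm_num
    rw [hpow, show ((3 : ℝ) + 1) / 3 = 4 / 3 by norm_num]
    simp only [ENNReal.ofReal_one, one_pow, one_mul, nsmul_eq_mul, smul_eq_mul]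
    rw [ENNReal.toReal_ofReal (by positivity)]
    push_cast
    field_simp
    ring
  · exact Filter.Eventually.of_forall fun v => by positivity

end PoissonVoronoi

theorem mainTheorem6 {Ω : Type*} [MeasurableSpace Ω] (P : Measure Ω) [IsProbabilityMeasure P]
    (lam : ℝ) (hlam : 0 < lam) (Φ : Ω → Set PoissonVoronoi.E3)
    (hΦ : PoissonVoronoi.IsHomogeneousPoisson P Φ lam)
    (lt : PoissonVoronoi.E3 → PoissonVoronoi.E3 → Prop) (hlt : PoissonVoronoi.IsNucleusOrder lt)
    (B : Set PoissonVoronoi.E3) (hB : MeasurableSet B) (hB0 : volume B ≠ 0) (hB1 : volume B ≠ ⊤)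
    (θ : ℝ) (hθ0 : 0 < θ) (hθ2 : θ < 2 * Real.pi) (hθ : θ ≠ Real.pi) :
    PoissonVoronoi.palmExpectation P Φ lam B (PoissonVoronoi.orderedLocusLength lt θ) =
      ENNReal.ofReal (4 * Real.pi * (6 / (Real.pi * lam)) ^ ((1 : ℝ) / 3) * Real.Gamma (4 / 3) *
        |Real.cos (θ / 2)| * Real.sin (θ / 2) ^ 3) := by
  have hsin := PoissonVoronoi.sin_half_pos hθ0 hθ2
  have hhalf := PoissonVoronoi.two_mul_setLIntegral_order hlt
    (f := PoissonVoronoi.discountedRadius lam θ) fun v => by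
      simp [PoissonVoronoi.discountedRadius]
  rw [PoissonVoronoi.lintegral_discountedRadius hlam hθ0 hθ2] at hhalf
  rw [PoissonVoronoi.palmExpectation, hΦ.lintegral_tsum_orderedLocusLength hlt hB hθ0 hθ2 hθ,
    setLIntegral_congr_fun measurableSet_Ioc fun t ht =>
      hΦ.lintegral_pairWeight_void hlam hlt hB hθ0 hθ2 hθ ht,
    setLIntegral_const, Real.volume_Ioc]
  have hl0 : ENNReal.ofReal lam ≠ 0 := by simpa using hlam
  refine Eq.symm ?_
  rw [ENNReal.eq_div_iff (mul_ne_zero hl0 hB0) (ENNReal.mul_ne_top (by simp) hB1),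
    show Real.pi - -Real.pi = Real.pi * 2 by ring, ENNReal.ofReal_mul Real.pi_pos.le,
    ENNReal.ofReal_ofNat]
  -- The prefactor `lam * π` is what remains of `lam ^ 2 * 2π` after dividing by the intensity and
  -- taking the half of the space selected by the order.
  have hsplit : 4 * Real.pi * (6 / (Real.pi * lam)) ^ ((1 : ℝ) / 3) * Real.Gamma (4 / 3) *
      |Real.cos (θ / 2)| * Real.sin (θ / 2) ^ 3 = lam * Real.pi * (4 / lam *
      (6 / (Real.pi * lam)) ^ ((1 : ℝ) / 3) * Real.Gamma (4 / 3) *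
        |Real.cos (θ / 2)| * Real.sin (θ / 2) ^ 3) := by
    field_simp
  rw [hsplit, ENNReal.ofReal_mul (by positivity), ENNReal.ofReal_mul hlam.le, ← hhalf]
  ring
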